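/- Let $S$ be a scheme, $G$ an $S$-group scheme, and $X$ a noetherian $S$-scheme with a left action $a : G\times_S X\to X$ of $G$ such that the second projection $p_2 : G\times_S X\to X$ is flat. A coherent $(G,\mathcal O_X)$-module is a coherent $\mathcal O_X$-module $\mathcal M$ together with a $G$-linearization, that is, an isomorphism $\Phi : a^*\mathcal M\to p_2^*\mathcal M$ satisfying the usual cocycle condition on $G\times_S G\times_S X$; a coherent $(G,\mathcal O_X)$-submodule is a coherent submodule $\mathcal N\subset\mathcal M$ with $\Phi(a^*\mathcal N)=p_2^*\mathcal N$, and a $G$-ideal is a $(G,\mathcal O_X)$-submodule of $\mathcal O_X$ (ideals are understood to be quasi-coherent). For an ideal $\mathfrak a$ of $\mathcal O_X$ let $\mathfrak a^*$ be the largest $G$-ideal contained in $\mathfrak a$. A $G$-ideal is called $G$-prime if it equals $\mathfrak p^*$ for some ideal $\mathfrak p$ such that the closed subscheme $V(\mathfrak p)$ is integral. The $G$-radical $\sqrt[G]{\mathcal I}$ of a $G$-ideal $\mathcal I$ is the largest $G$-ideal contained in every $G$-prime $G$-ideal that contains $\mathcal I$ (it is $\mathcal O_X$ if there is no such $G$-prime).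 A coherent $(G,\mathcal O_X)$-submodule $\mathcal Q$ of $\mathcal M$ is called $G$-primary if $\mathcal Q\ne\mathcal M$ and, for every coherent $(G,\mathcal O_X)$-submodule $\mathcal L$ of $\mathcal M$ and every $G$-ideal $\mathcal I$, the conditions $\mathcal I\mathcal L\subset\mathcal Q$ and $\mathcal L\not\subset\mathcal Q$ imply $\mathcal I\subset\sqrt[G]{\mathcal Q:\mathcal M}$. An expression $\mathcal N=\mathcal Q_1\cap\dots\cap\mathcal Q_r$ is a minimal $G$-primary decomposition if every $\mathcal Q_i$ is $G$-primary, $\bigcap_{j\ne i}\mathcal Q_j\neq\mathcal N$ for every $i$, and $\sqrt[G]{\mathcal Q_i:\mathcal M}\ne\sqrt[G]{\mathcal Q_j:\mathcal M}$ for $i\neq j$ (for $r=0$ the intersection is $\mathcal M$). Let $\mathcal M$ be a coherent $(G,\mathcal O_X)$-module, $\mathcal N$ a coherent $(G,\mathcal O_X)$-submodule, $\mathcal N=\mathcal Q_1\cap\dots\cap\mathcal Q_r$ a minimal $G$-primary decomposition, and $\mathcal P_i=\sqrt[G]{\mathcal Q_i:\mathcal M}$. Then $$\{\mathcal P_1,\dots,\mathcal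 P_r\}=\{\mathcal N:\mathcal L\mid \mathcal L \text{ is a coherent } (G,\mathcal O_X)\text{-submodule of }\mathcal M\text{ and }\mathcal N:\mathcal L\text{ is }G\text{-prime}\}.$$ In particular, this set, denoted $\mathrm{Ass}_G(\mathcal M/\mathcal N)$, is independent of the choice of the minimal $G$-primary decomposition of $\mathcal N$, and it depends only on the quotient: if $\mathcal M'$ is a coherent $(G,\mathcal O_X)$-module with a coherent $(G,\mathcal O_X)$-submodule $\mathcal N'$ such that $\mathcal M/\mathcal N\cong\mathcal M'/\mathcal N'$ as $(G,\mathcal O_X)$-modules, then minimal $G$-primary decompositions of $\mathcal N$ in $\mathcal M$ and of $\mathcal N'$ in $\mathcal M'$ give the same set. -/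

import Mathlib

universe u

open CategoryTheory AlgebraicGeometry MonoidalCategory CartesianMonoidalCategory

noncomputable section

namespace GPrimary

/-! ### Submodules of a sheaf of modules -/

section Submodules

variable {X Y : Scheme.{u}}

/-- A coherent submodule `N` of a (quasi-coherent) `𝒪_X`-module `M` on a noetherian scheme `X`,
given, in the same way as Mathlib's `Scheme.IdealSheafData` for quasi-coherent ideals, by its
sections on the affine open subsets: finitely generated submodules `N(U) ⊆ M(U)` such that
`N(D(f)) = N(U)_f`, i.e. `N(D(f))` is the `𝒪_X(D(f))`-span of the restrictions of the
elements of `N(U)`. -/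
structure CoherentSubmodule (M : X.Modules) where
  /-- The sections on an affine open subset. -/
  sections : ∀ U : X.affineOpens, Submodule Γ(X, U) Γ(M, U)
  span_basicOpen : ∀ (U : X.affineOpens) (f : Γ(X, U)),
    Submodule.span Γ(X, X.basicOpen f)
      ((fun m => M.presheaf.map (homOfLE (X.basicOpen_le f)).op m) ''
        (sections U : Set Γ(M, U))) = sections (X.affineBasicOpen f)
  fg : ∀ U : X.affineOpens, (sections U).FG

/-- For `f : Y ⟶ X` and open subsets `W ⊆ f⁻¹(U)`, the canonical map `M(U) → (f^*M)(W)`. -/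
def pullbackSection (f : Y ⟶ X) (M : X.Modules) (U : X.Opens) (W : Y.Opens)
    (h : W ≤ f ⁻¹ᵁ U) : Γ(M, U) →+ Γ((Scheme.Modules.pullback f).obj M, W) :=
  AddMonoidHom.comp
    (((Scheme.Modules.pullback f).obj M).presheaf.map (homOfLE h).op).hom
    (((Scheme.Modules.pullbackPushforwardAdjunction f).unit.app M).app U).hom

/-- For affine open subsets `U ⊆ X` and `W ⊆ Y` with `W ⊆ f⁻¹(U)`, the sections on `W` of the
image of `f^*N` in `f^*M`. -/
def CoherentSubmodule.pullbackSections {M : X.Modules} (N : CoherentSubmodule M) (f : Y ⟶ X)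
    (U : X.affineOpens) (W : Y.affineOpens) (h : W.1 ≤ f ⁻¹ᵁ U.1) :
    Submodule Γ(Y, W) Γ((Scheme.Modules.pullback f).obj M, W) :=
  Submodule.span Γ(Y, W) (pullbackSection f M U W h '' (N.sections U : Set Γ(M, U)))

/-- The colon ideal `N : L` of two families of submodules of the modules `M(U)`, `U ⊆ X` affine
open. When `N` and `L` come from coherent submodules of a coherent module on a noetherian scheme,
the ideals `N(U) : L(U)` are compatible with localization, and are the sections of `N : L`. -/
def colon {M : X.Modules} (N L : ∀ U : X.affineOpens, Submodule Γ(X, U) Γ(M, U)) :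
    X.IdealSheafData :=
  Scheme.IdealSheafData.ofIdeals fun U => (N U).colon (L U : Set Γ(M, U))

end Submodules

/-! ### Group actions and equivariant modules -/

variable {S : Scheme.{u}} (G X : Over S) [GrpObj G]

/-- The scheme `G ×_S X`. -/
abbrev GX : Scheme.{u} := (G ⊗ X).left

/-- The scheme `G ×_S G ×_S X`. -/
abbrev GGX : Scheme.{u} := (G ⊗ (G ⊗ X)).left

/-- The second projection `p₂ : G ×_S X ⟶ X`. -/
def proj : GX G X ⟶ X.left := (snd G X).left

/-- `μ × 1_X : G ×_S G ×_S X ⟶ G ×_S X`. -/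
def mulX : GGX G X ⟶ GX G X := ((α_ G G X).inv ≫ (MonObj.mul (X := G) ▷ X)).left

/-- `p₂₃ : G ×_S G ×_S X ⟶ G ×_S X`. -/
def projG : GGX G X ⟶ GX G X := (snd G (G ⊗ X)).left

lemma mulX_proj : mulX G X ≫ proj G X = projG G X ≫ proj G X := by
  simp only [mulX, proj, projG, ← Over.comp_left]
  congr 1
  simp

variable [ModObj G X]

/-- The action `a : G ×_S X ⟶ X`. -/
def act : GX G X ⟶ X.left := (ModObj.smul (M := G) (X := X) : G ⊗ X ⟶ X).left

/-- `1_G × a : G ×_S G ×_S X ⟶ G ×_S X`. -/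
def actG : GGX G X ⟶ GX G X := (G ◁ (ModObj.smul (M := G) (X := X) : G ⊗ X ⟶ X)).left

lemma mulX_act : mulX G X ≫ act G X = actG G X ≫ act G X := by
  have h := ModObj.assoc_flip (M := G) X
  simp only [mulX, act, actG, ← Over.comp_left]
  congr 1
  rw [Category.assoc]
  exact h.symm

lemma actG_proj : actG G X ≫ proj G X = projG G X ≫ act G X := by
  simp only [actG, proj, projG, act, ← Over.comp_left]
  congr 1
  simp

variable {G X}

/-- The pullback `f^*Φ` of a map `Φ : a^*M ⟶ p₂^*M` along `f : T ⟶ G ×_S X`, as a map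
`(a f)^*M ⟶ (p₂ f)^*M`. -/
def pullbackMap {T : Scheme.{u}} (f : T ⟶ GX G X) {M : X.left.Modules}
    (Φ : (Scheme.Modules.pullback (act G X)).obj M ⟶ (Scheme.Modules.pullback (proj G X)).obj M) :
    (Scheme.Modules.pullback (f ≫ act G X)).obj M ⟶
      (Scheme.Modules.pullback (f ≫ proj G X)).obj M :=
  (Scheme.Modules.pullbackComp f (act G X)).inv.app M ≫
    (Scheme.Modules.pullback f).map Φ ≫ (Scheme.Modules.pullbackComp f (proj G X)).hom.app M

variable (G X)

/-- A coherent `(G, 𝒪_X)`-module on a noetherian `G`-scheme `X`: a coherent (i.e. quasi-coherent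
and finite type) `𝒪_X`-module `M` with a `G`-linearization, i.e. an isomorphism
`Φ : a^*M ≅ p₂^*M` satisfying the cocycle condition
`(μ × 1_X)^*Φ = p₂₃^*Φ ∘ (1_G × a)^*Φ` over `G ×_S G ×_S X`. -/
structure CoherentGModule where
  /-- The underlying `𝒪_X`-module. -/
  carrier : X.left.Modules
  isQuasicoherent : carrier.IsQuasicoherent
  isFiniteType : carrier.IsFiniteType
  /-- The `G`-linearization. -/
  lin : (Scheme.Modules.pullback (act G X)).obj carrier ≅
    (Scheme.Modules.pullback (proj G X)).obj carrier
  cocycle : pullbackMap (mulX G X) lin.hom =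
    (Scheme.Modules.pullbackCongr (mulX_act G X)).hom.app carrier ≫
      pullbackMap (actG G X) lin.hom ≫
      (Scheme.Modules.pullbackCongr (actG_proj G X)).hom.app carrier ≫
      pullbackMap (projG G X) lin.hom ≫
      (Scheme.Modules.pullbackCongr (mulX_proj G X)).inv.app carrier

variable {G X}

/-- `(G, 𝒪_X)`-linearity of a morphism `φ : M ⟶ K`: `Ψ ∘ a^*φ = p₂^*φ ∘ Φ`. -/
def IsEquivariant {M K : CoherentGModule G X} (φ : M.carrier ⟶ K.carrier) : Prop :=
  (Scheme.Modules.pullback (act G X)).map φ ≫ K.lin.hom =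
    M.lin.hom ≫ (Scheme.Modules.pullback (proj G X)).map φ

/-- A coherent `(G, 𝒪_X)`-submodule `N` of `M`: a coherent submodule such that
`Φ(a^*N) = p₂^*N` as submodules of `p₂^*M` (checked on the affine open subsets `W ⊆ G ×_S X`
that are mapped into affine open subsets of `X` by both `a` and `p₂`; they form a base). -/
structure GSubmodule (M : CoherentGModule G X) extends CoherentSubmodule M.carrier where
  equivariant : ∀ (U V : X.left.affineOpens) (W : (GX G X).affineOpens)
    (hU : W.1 ≤ act G X ⁻¹ᵁ U.1) (hV : W.1 ≤ proj G X ⁻¹ᵁ V.1),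
    (fun x => M.lin.hom.app W x) ''
      (toCoherentSubmodule.pullbackSections (act G X) U W hU :
        Set Γ((Scheme.Modules.pullback (act G X)).obj M.carrier, W)) =
      (toCoherentSubmodule.pullbackSections (proj G X) V W hV :
        Set Γ((Scheme.Modules.pullback (proj G X)).obj M.carrier, W))

/-! ### `G`-ideals, `G`-prime ideals and `G`-radicals -/

variable (G) in
/-- A (quasi-coherent) ideal `I` of `𝒪_X` is a `G`-ideal if its extensions to
`𝒪_{G ×_S X}` along `a` and along `p₂` agree. -/
def IsGIdeal (I : X.left.IdealSheafData) : Prop :=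
  I.comap (act G X) = I.comap (proj G X)

variable (G) in
/-- `𝔞^*`, the largest `G`-ideal contained in the ideal `𝔞`. -/
def star (𝔞 : X.left.IdealSheafData) : X.left.IdealSheafData :=
  sSup {J | IsGIdeal G J ∧ J ≤ 𝔞}

variable (G) in
/-- A `G`-ideal is `G`-prime if it is of the form `𝔭^*` for a prime ideal `𝔭` of `𝒪_X`, i.e. an
ideal `𝔭` such that the closed subscheme `V(𝔭)` is integral. -/
def IsGPrime (P : X.left.IdealSheafData) : Prop :=
  IsGIdeal G P ∧ ∃ 𝔭 : X.left.IdealSheafData, IsIntegral 𝔭.subscheme ∧ P = star G 𝔭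

variable (G) in
/-- The `G`-radical of `I`: the largest `G`-ideal contained in all `G`-prime `G`-ideals
containing `I` (it is `𝒪_X` if there are none). -/
def gRadical (I : X.left.IdealSheafData) : X.left.IdealSheafData :=
  sSup {J | IsGIdeal G J ∧ ∀ P, IsGPrime G P → I ≤ P → J ≤ P}

/-! ### `G`-primary submodules and decompositions -/

variable {M : CoherentGModule G X}

/-- The colon ideal `N : L`. -/
def GSubmodule.colon (N L : GSubmodule M) : X.left.IdealSheafData :=
  GPrimary.colon N.sections L.sections

/-- The colon ideal `N : M`. -/
def GSubmodule.colonTop (N : GSubmodule M) : X.left.IdealSheafData :=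
  GPrimary.colon N.sections (fun _ => ⊤)

/-- `N` is a `G`-primary submodule of `M`: `N ≠ M`, and whenever `I L ⊆ N` and `L ⊄ N` for a
`(G, 𝒪_X)`-submodule `L` of `M` and a `G`-ideal `I`, then `I` is contained in the `G`-radical
of `N : M`. -/
def GSubmodule.IsGPrimary (N : GSubmodule M) : Prop :=
  (∃ U, N.sections U ≠ ⊤) ∧
    ∀ (L : GSubmodule M) (I : X.left.IdealSheafData), IsGIdeal G I →
      (∀ U, I.ideal U • L.sections U ≤ N.sections U) →
      ¬ (∀ U, L.sections U ≤ N.sections U) →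
      I ≤ gRadical G N.colonTop

/-- `N = Q_1 ∩ … ∩ Q_r` is a minimal `G`-primary decomposition. (The intersection of the empty
family is `M`.) -/
structure IsMinimalGPrimaryDecomposition (N : GSubmodule M) {r : ℕ}
    (Q : Fin r → GSubmodule M) : Prop where
  eq_inf : ∀ U, N.sections U = ⨅ i, (Q i).sections U
  primary : ∀ i, (Q i).IsGPrimary
  irredundant : ∀ i, ¬ ∀ U, N.sections U = ⨅ j, ⨅ _ : j ≠ i, (Q j).sections U
  radical_ne : ∀ i j, i ≠ j → gRadical G (Q i).colonTop ≠ gRadical G (Q j).colonTop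

/-- The morphism `π : M ⟶ K` exhibits the `(G, 𝒪_X)`-module `K` as the quotient `M / N`: it is a
`(G, 𝒪_X)`-linear epimorphism with kernel `N`. -/
structure IsQuotient (N : GSubmodule M) {K : CoherentGModule G X}
    (π : M.carrier ⟶ K.carrier) : Prop where
  epi : Epi π
  equivariant : IsEquivariant π
  ker : ∀ (U : X.left.affineOpens) (m : Γ(M.carrier, U)),
    m ∈ N.sections U ↔ π.app U m = 0

end GPrimary

end

noncomputable section

namespace GPrimary

/-! The argument is Noether's uniqueness proof for primary decompositions, with ideals replaced by
`G`-ideals. Three facts carry it.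

A proper `G`-ideal that is prime with respect to products of `G`-ideals is `G`-prime
(`isGPrime_of_prime`), and conversely (`IsGPrime.le_or_le`). On a noetherian scheme some power of
the `G`-radical of a `G`-ideal `I` lies in `I` (`exists_gRadical_pow_le`). Hence the `G`-radical
attached to a `G`-primary submodule is `G`-prime (`GSubmodule.IsGPrimary.isGPrime_gRadical`).

Given `N = ⋂ Q_i` and `P_i` the radical of `Q_i : M`, put `N' = ⋂_{j ≠ i} Q_j`. Some power of `P_i`
carries `N'` into `N`; if `n` is the least such exponent, then `n > 0` by irredundancy, and `L =
P_i^(n-1) N'` satisfies `N : L = P_i`. Conversely, if `N : L` is `G`-prime, it contains the product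
of the `Q_i : L`, hence one of them, and primariness of that `Q_i` forces `N : L = P_i`. Colons `N :
L` are colons `0 : L̄` in `M / N`, with `L̄` the image of `L`, so the set depends only on the
quotient (`IsQuotient.exists_colon_iff`).

All this requires products, finite intersections, colons, images and preimages to stay equivariant.
Equivariance compares pullbacks along `a` and `p₂`. Over affine opens these are base changes of
modules (`isBaseChangeAlong_pullbackSection`), and both maps are flat, so the claims reduce to flat
base change of submodules (`IsBaseChangeAlong.comap_span_image` and its consequences). -/

lemma bijective_map_of_isIso_counit {C D : Type*} [Category* C] [Category* D] {L : C ⥤ D}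
    {H : D ⥤ C} (adj : L ⊣ H) (P T : D) [IsIso (adj.counit.app P)] :
    Function.Bijective (fun φ : P ⟶ T => H.map φ) := by
  have : (fun φ : P ⟶ T => H.map φ) =
      (adj.homEquiv _ _) ∘ (fun φ => adj.counit.app P ≫ φ) := by
    ext φ
    simp [Adjunction.homEquiv_unit]
  rw [this]
  exact (Equiv.bijective _).comp ((asIso (adj.counit.app P)).homFromEquiv (Z := T)).symm.bijective

/-! ### Morphisms out of a quasi-coherent module, read off on one affine open. -/

section Affine

variable {R : CommRingCat.{u}}

lemma existsUnique_hom_app_top (P T : (Spec R).Modules) [IsIso P.fromTildeΓ]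
    (l : Γ(P, ⊤) →ₗ[R] Γ(T, ⊤)) : ∃! φ : P ⟶ T, ∀ x, φ.app ⊤ x = l x := by
  have h := @bijective_map_of_isIso_counit _ _ _ _ _ _ (tilde.adjunction (R := R)) P T
    (inferInstanceAs (IsIso P.fromTildeΓ))
  obtain ⟨φ, hφ⟩ := h.2 (@ModuleCat.ofHom R _ Γ(P, ⊤) Γ(T, ⊤) _ _ _ _ l)
  refine ⟨φ, fun x => congr($hφ x), fun ψ hψ => h.1 ?_⟩
  refine ModuleCat.hom_ext (LinearMap.ext fun x => ?_)
  exact (hψ x).trans congr($hφ x).symm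

end Affine

section OpenImmersion

variable {X : Scheme.{u}} {R : CommRingCat.{u}} (i : Spec R ⟶ X) [IsOpenImmersion i]

/-- By the adjunction between restriction and pushforward along `i`, this is the affine statement
for `M.restrict i`; the work lies in matching the two scalar actions. -/
lemma existsUnique_hom_pushforward (M : X.Modules) (T : (Spec R).Modules)
    [IsIso (M.restrict i).fromTildeΓ]
    (l : Γ(M, i ''ᵁ ⊤) →ₗ[Γ(X, i ''ᵁ ⊤)] Γ((Scheme.Modules.pushforward i).obj T, i ''ᵁ ⊤)) :
    ∃! φ : M ⟶ (Scheme.Modules.pushforward i).obj T, ∀ x, φ.app (i ''ᵁ ⊤) x = l x := by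
  let e : i ⁻¹ᵁ (i ''ᵁ ⊤) = ⊤ := i.preimage_image_eq ⊤
  let t : Γ(T, i ⁻¹ᵁ (i ''ᵁ ⊤)) ⟶ Γ(T, ⊤) := T.presheaf.map (eqToHom e.symm).op
  have ht : Function.Bijective t := ConcreteCategory.bijective_of_isIso t
  let l' : Γ(M.restrict i, ⊤) →ₗ[R] Γ(T, ⊤) :=
    { toFun := fun x => t (l ((M.restrictAppIso i ⊤).hom x))
      map_add' := fun x y => by
        rw [map_add]
        exact (congrArg t (l.map_add _ _)).trans (t.hom.map_add _ _)
      map_smul' := fun r x => by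
        simp only [RingHom.id_apply]
        rw [Scheme.Modules.smul_Spec_def, Scheme.Modules.smul_Spec_def]
        generalize ((Spec R).presheaf.map _) _ = s
        have h1 : (M.restrictAppIso i ⊤).hom (s • x) =
          ((i.appIso ⊤).inv s) • (M.restrictAppIso i ⊤).hom x := rfl
        rw [h1, map_smul]
        have h2 : ∀ y : Γ((Scheme.Modules.pushforward i).obj T, i ''ᵁ ⊤),
          (((i.appIso ⊤).inv s) • y) = (show Γ(T, i ⁻¹ᵁ (i ''ᵁ ⊤)) from
            i.app _ ((i.appIso ⊤).inv s) • (show Γ(T, i ⁻¹ᵁ (i ''ᵁ ⊤)) from y)) := fun y => rfl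
        rw [h2]
        refine (Scheme.Modules.map_smul _ _ _ _).trans ?_
        congr 1
        have := i.appIso_inv_app_presheafMap ⊤
        exact congr($this s) }
  obtain ⟨ψ, hψ, hu⟩ := existsUnique_hom_app_top (M.restrict i) T l'
  have key : ∀ (χ : M.restrict i ⟶ T) (x : Γ(M, i ''ᵁ ⊤)),
      t (((Scheme.Modules.restrictAdjunction i).homEquiv M T χ).app (i ''ᵁ ⊤) x) =
        χ.app ⊤ ((M.restrictAppIso i ⊤).inv x) := by
    intro χ x
    rw [Adjunction.homEquiv_unit]
    have h1 := χ.mapPresheaf.naturality (eqToHom e.symm).op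
    have h2 := congr($h1 (M.presheaf.map (homOfLE (i.image_preimage_le (i ''ᵁ ⊤))).op x))
    refine Eq.trans h2.symm ?_
    change χ.app ⊤ _ = _
    congr 1
    change M.presheaf.map _ (M.presheaf.map _ x) = x
    rw [← M.presheaf.map_comp_apply]
    exact congr($(M.presheaf.map_id _) x)
  refine ⟨(Scheme.Modules.restrictAdjunction i).homEquiv M T ψ, fun x => ht.1 ?_, fun φ hφ => ?_⟩
  · rw [key, hψ]
    rfl
  · obtain ⟨χ, rfl⟩ := ((Scheme.Modules.restrictAdjunction i).homEquiv M T).surjective φ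
    rw [hu χ]
    intro x
    have := key χ ((M.restrictAppIso i ⊤).hom x)
    rw [hφ] at this
    exact this.symm
end OpenImmersion

/-! ### Quasi-coherence of pullbacks over affine opens. -/

section

variable {X Y : Scheme.{u}}

lemma isIso_fromTildeΓ_pullback {A B : CommRingCat.{u}} (g : Spec B ⟶ Spec A)
    (P : (Spec A).Modules) [IsIso P.fromTildeΓ] :
    IsIso ((Scheme.Modules.pullback g).obj P).fromTildeΓ := by
  -- Finality, which holds because the preimage of `⊤` is `⊤`, makes the pullback of the structure
  -- sheaf the structure sheaf. A presentation of `P` then pulls back to a presentation.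
  have : (TopologicalSpace.Opens.map g.base).Final :=
    Functor.final_of_exists_of_isFiltered _ (fun W => ⟨⊤, ⟨homOfLE le_top⟩⟩)
      (fun s s' => ⟨_, 𝟙 _, Subsingleton.elim _ _⟩)
  have hadj : (SheafOfModules.pushforward.{u} g.toRingCatSheafHom).IsRightAdjoint :=
    (Scheme.Modules.pullbackPushforwardAdjunction g).isRightAdjoint
  have hadj' : (Scheme.Modules.pullback g).IsLeftAdjoint :=
    (Scheme.Modules.pullbackPushforwardAdjunction g).isLeftAdjoint
  have hiso : IsIso (SheafOfModules.pullbackObjUnitToUnit g.toRingCatSheafHom) :=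
    SheafOfModules.instIsIsoPullbackObjUnitToUnitOfFinal (F := TopologicalSpace.Opens.map g.base) _
  let η : SheafOfModules.unit (Spec B).ringCatSheaf ≅
      (Scheme.Modules.pullback g).obj (SheafOfModules.unit (Spec A).ringCatSheaf) :=
    (asIso (SheafOfModules.pullbackObjUnitToUnit g.toRingCatSheafHom)).symm
  let pres := presentationTilde ((modulesSpecToSheaf.obj P).presheaf.obj (.op ⊤)) .univ (by simp) _
    (Submodule.span_eq _)
  let F : SheafOfModules.{u} (Spec A).ringCatSheaf ⥤ SheafOfModules.{u} (Spec B).ringCatSheaf :=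
    Scheme.Modules.pullback g
  have hF : Limits.PreservesColimitsOfSize.{u, u} (Scheme.Modules.pullback g) := inferInstance
  have hF' : Limits.PreservesColimitsOfSize.{u, u} F := hF
  let ψ := (Scheme.Modules.pullback g).map P.fromTildeΓ
  have hψ : IsIso ψ := inferInstance
  have hψ' : IsIso (F.map P.fromTildeΓ) := hψ
  exact isIso_fromTildeΓ_of_presentation _ ((pres.map F η).ofIsIso (F.map P.fromTildeΓ))

lemma isIso_fromTildeΓ_of_iso {A : CommRingCat.{u}} {P Q : (Spec A).Modules} (e : P ≅ Q)
    [h : IsIso P.fromTildeΓ] : IsIso Q.fromTildeΓ := by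
  rw [isIso_fromTildeΓ_iff] at h ⊢
  exact Functor.essImage.ofIso e h

instance (U : X.affineOpens) : IsOpenImmersion (IsAffineOpen.fromSpec U.2) :=
  IsAffineOpen.isOpenImmersion_fromSpec U.2

instance (M : X.Modules) [M.IsQuasicoherent] (U : X.affineOpens) :
    IsIso (M.restrict U.2.fromSpec).fromTildeΓ := inferInstance

lemma isIso_fromTildeΓ_restrict_pullback (f : Y ⟶ X) (M : X.Modules) [M.IsQuasicoherent]
    (U : X.affineOpens) (W : Y.affineOpens) (h : W.1 ≤ f ⁻¹ᵁ U.1) :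
    IsIso (((Scheme.Modules.pullback f).obj M).restrict W.2.fromSpec).fromTildeΓ := by
  have e : Spec.map (f.appLE U W h) ≫ U.2.fromSpec = W.2.fromSpec ≫ f :=
    U.2.SpecMap_appLE_fromSpec f W.2 h
  have := isIso_fromTildeΓ_pullback (Spec.map (f.appLE U W h)) (M.restrict U.2.fromSpec)
  exact isIso_fromTildeΓ_of_iso (
    (Scheme.Modules.pullback (Spec.map (f.appLE U W h))).mapIso
      ((Scheme.Modules.restrictFunctorIsoPullback U.2.fromSpec).app M) ≪≫
    (Scheme.Modules.pullbackComp (Spec.map (f.appLE U W h)) U.2.fromSpec).app M ≪≫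
    (Scheme.Modules.pullbackCongr e).app M ≪≫
    (Scheme.Modules.pullbackComp W.2.fromSpec f).symm.app M ≪≫
    ((Scheme.Modules.restrictFunctorIsoPullback W.2.fromSpec).app _).symm)

lemma existsUnique_hom_of_iso {R : CommRingCat.{u}} (i : Spec R ⟶ X) [IsOpenImmersion i]
    (U : X.Opens) (hU : i ''ᵁ ⊤ = U) (M K : X.Modules) (T : (Spec R).Modules)
    [IsIso (M.restrict i).fromTildeΓ] (e : K ≅ (Scheme.Modules.pushforward i).obj T)
    (l : Γ(M, U) →ₗ[Γ(X, U)] Γ(K, U)) :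
    ∃! φ : M ⟶ K, ∀ x, φ.app U x = l x := by
  subst hU
  let el : Γ(K, i ''ᵁ ⊤) →ₗ[Γ(X, i ''ᵁ ⊤)] Γ((Scheme.Modules.pushforward i).obj T, i ''ᵁ ⊤) :=
    { (e.hom.app (i ''ᵁ ⊤)).hom with
      map_smul' := fun r x => e.hom.app_smul r x }
  have he : ∀ x, e.inv.app (i ''ᵁ ⊤) (e.hom.app (i ''ᵁ ⊤) x) = x := fun x => by
    have := congr(Scheme.Modules.Hom.app $(e.hom_inv_id) (i ''ᵁ ⊤))
    exact congr($this x)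
  obtain ⟨φ, hφ, hu⟩ := existsUnique_hom_pushforward i M T (el ∘ₗ l)
  refine ⟨φ ≫ e.inv, fun x => ?_, fun ψ hψ => ?_⟩
  · refine Eq.trans ?_ (he (l x))
    exact congrArg _ (hφ x)
  · rw [Iso.eq_comp_inv]
    refine hu _ fun x => ?_
    exact congrArg (e.hom.app (i ''ᵁ ⊤)) (hψ x)

end

/-! ### Sections of a pullback over affine opens as a base change. -/

/-- `ρ : M → M'` exhibits the `B`-module `M'` as the base change of the `A`-module `M` along
`φ : A → B`. -/
structure IsBaseChangeAlong {A B M M' : Type*} [CommRing A] [CommRing B] [AddCommGroup M]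
    [AddCommGroup M'] [Module A M] [Module B M'] (φ : A →+* B) (ρ : M →+ M') : Prop where
  map_smul : ∀ (a : A) (m : M), ρ (a • m) = φ a • ρ m
  isBaseChange :
    letI := φ.toAlgebra
    letI := Module.compHom M' φ
    haveI : IsScalarTower A B M' := ⟨fun a b m => mul_smul (φ a) b m⟩
    IsBaseChange B ({ ρ with map_smul' := map_smul } : M →ₗ[A] M')

lemma isBaseChangeAlong_of_existsUnique {A B M M' : Type u} [CommRing A] [CommRing B]
    [AddCommGroup M] [AddCommGroup M'] [Module A M] [Module B M'] (φ : A →+* B) (ρ : M →+ M')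
    (map_smul : ∀ (a : A) (m : M), ρ (a • m) = φ a • ρ m)
    (h : ∀ (Q : Type u) [AddCommGroup Q] [Module B Q] (g : M →+ Q),
      (∀ a m, g (a • m) = φ a • g m) → ∃! g' : M' →ₗ[B] Q, ∀ m, g' (ρ m) = g m) :
    IsBaseChangeAlong φ ρ where
  map_smul := map_smul
  isBaseChange := by
    let := φ.toAlgebra
    let := Module.compHom M' φ
    have : IsScalarTower A B M' := ⟨fun a b m => mul_smul (φ a) b m⟩
    refine IsBaseChange.of_lift_unique _ fun Q _ _ _ _ g => ?_
    let : AddCommGroup Q := Module.addCommMonoidToAddCommGroup B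
    obtain ⟨g', h1, h2⟩ := h Q g.toAddMonoidHom fun a m => by
      change g (a • m) = φ a • g m
      rw [_root_.map_smul]
      exact (algebraMap_smul B a (g m)).symm
    exact ⟨g', LinearMap.ext h1, fun g'' hg => h2 g'' fun m => congr($hg m)⟩

section

variable {X Y : Scheme.{u}}

lemma bijective_presheaf_map_of_eq (M : X.Modules) {U V : X.Opens} (h : U = V) (i : U ⟶ V) :
    Function.Bijective (M.presheaf.map i.op) := by
  subst h
  rw [Subsingleton.elim i (𝟙 _)]
  exact ConcreteCategory.bijective_of_isIso _

/-- Supplies the test modules for the universal property of base change: any module over `Γ(Y, W)`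
comes from a sheaf pushed forward from `W`. -/
lemma exists_linearEquiv_pushforward_tilde (W : Y.affineOpens) (Q : Type u) [AddCommGroup Q]
    [Module Γ(Y, W) Q] :
    ∃ T : (Spec Γ(Y, W)).Modules,
      Nonempty (Q ≃ₗ[Γ(Y, W)] Γ((Scheme.Modules.pushforward W.2.fromSpec).obj T, W.1)) := by
  let T := tilde (ModuleCat.of Γ(Y, W) Q)
  have e : W.2.fromSpec ⁻¹ᵁ W.1 = ⊤ := W.2.fromSpec_preimage_self
  let r : Γ(T, ⊤) →+ Γ(T, W.2.fromSpec ⁻¹ᵁ W.1) := (T.presheaf.map (eqToHom e).op).hom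
  have hr : Function.Bijective r := bijective_presheaf_map_of_eq T e _
  let t : Q →ₗ[Γ(Y, W)] Γ(T, ⊤) := (tilde.isoTop (ModuleCat.of Γ(Y, W) Q)).hom.hom
  have ht : Function.Bijective t :=
    ConcreteCategory.bijective_of_isIso (tilde.isoTop (ModuleCat.of Γ(Y, W) Q)).hom
  refine ⟨T, ⟨LinearEquiv.ofBijective
    (M₂ := Γ((Scheme.Modules.pushforward W.2.fromSpec).obj T, W.1))
    { r.comp t.toAddMonoidHom with
      map_smul' := fun b q => ?_ } (hr.comp ht)⟩⟩
  change r (t (b • q)) = (show Γ(T, W.2.fromSpec ⁻¹ᵁ W.1) from W.2.fromSpec.app W b • r (t q))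
  rw [t.map_smul, Scheme.Modules.smul_Spec_def, W.2.fromSpec_app_self]
  refine (Scheme.Modules.map_smul _ _ _ _).trans ?_
  congr 1

lemma pullbackSection_smul (f : Y ⟶ X) (M : X.Modules) (U : X.Opens) (W : Y.Opens)
    (h : W ≤ f ⁻¹ᵁ U) (a : Γ(X, U)) (m : Γ(M, U)) :
    pullbackSection f M U W h (a • m) = f.appLE U W h a • pullbackSection f M U W h m := by
  simp only [pullbackSection]
  have h1 := ((Scheme.Modules.pullbackPushforwardAdjunction f).unit.app M).app_smul a m
  refine (congrArg _ h1).trans ?_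
  exact Scheme.Modules.map_smul _ _ _ _

lemma homEquiv_app_res (f : Y ⟶ X) (M : X.Modules) (K : Y.Modules) (U : X.Opens) (W : Y.Opens)
    (h : W ≤ f ⁻¹ᵁ U) (ψ : (Scheme.Modules.pullback f).obj M ⟶ K) (m : Γ(M, U)) :
    K.presheaf.map (homOfLE h).op
      (((Scheme.Modules.pullbackPushforwardAdjunction f).homEquiv M K ψ).app U m) =
      ψ.app W (pullbackSection f M U W h m) := by
  rw [Adjunction.homEquiv_unit]
  have h1 := ψ.mapPresheaf.naturality (homOfLE h).op
  exact (congr($h1 (((Scheme.Modules.pullbackPushforwardAdjunction f).unit.app M).app U m))).symm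

/-- Realize a test module `Q` as `K(W)` with `K` pushed forward from `W`. Morphisms `f^*M ⟶ K` are
morphisms `M ⟶ f_*K`; since `W` maps into `U`, `f_*K` is pushed forward from `U`, so these are
linear maps `M(U) → K(f⁻¹U) = K(W) = Q`. -/
theorem isBaseChangeAlong_pullbackSection (f : Y ⟶ X) (M : X.Modules) [M.IsQuasicoherent]
    (U : X.affineOpens) (W : Y.affineOpens) (h : W.1 ≤ f ⁻¹ᵁ U.1) :
    IsBaseChangeAlong (f.appLE U W h).hom (pullbackSection f M U W h) := by
  refine isBaseChangeAlong_of_existsUnique _ _ (pullbackSection_smul f M U W h) ?_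
  intro Q _ _ g hg
  obtain ⟨T, ⟨ε⟩⟩ := exists_linearEquiv_pushforward_tilde W Q
  let K := (Scheme.Modules.pushforward W.2.fromSpec).obj T
  have e : Spec.map (f.appLE U W h) ≫ U.2.fromSpec = W.2.fromSpec ≫ f :=
    U.2.SpecMap_appLE_fromSpec f W.2 h
  let κ : (Scheme.Modules.pushforward f).obj K ≅ (Scheme.Modules.pushforward U.2.fromSpec).obj
      ((Scheme.Modules.pushforward (Spec.map (f.appLE U W h))).obj T) :=
    (Scheme.Modules.pushforwardComp W.2.fromSpec f).app T ≪≫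
    (Scheme.Modules.pushforwardCongr e.symm).app T ≪≫
    (Scheme.Modules.pushforwardComp _ _).symm.app T
  have hU : U.2.fromSpec ''ᵁ ⊤ = U.1 := by
    rw [Scheme.Hom.image_top_eq_opensRange, U.2.opensRange_fromSpec]
  have hW : W.2.fromSpec ''ᵁ ⊤ = W.1 := by
    rw [Scheme.Hom.image_top_eq_opensRange, W.2.opensRange_fromSpec]
  let res : Γ(K, f ⁻¹ᵁ U.1) →+ Γ(K, W.1) := (K.presheaf.map (homOfLE h).op).hom
  have hres : Function.Bijective res := by
    refine bijective_presheaf_map_of_eq T ?_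
      ((TopologicalSpace.Opens.map W.2.fromSpec.base).map (homOfLE h))
    have e1 : W.2.fromSpec ⁻¹ᵁ W.1 = ⊤ := W.2.fromSpec_preimage_self
    have e2 : W.2.fromSpec ⁻¹ᵁ W.1 ≤ W.2.fromSpec ⁻¹ᵁ (f ⁻¹ᵁ U.1) := fun x hx => h hx
    exact le_antisymm e2 (le_top.trans e1.ge)
  let res' : Γ(K, f ⁻¹ᵁ U.1) ≃+ Γ(K, W.1) := AddEquiv.ofBijective res hres
  have res_smul : ∀ (a : Γ(X, U)) (x : Γ((Scheme.Modules.pushforward f).obj K, U.1)),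
      res (a • x) = f.appLE U W h a • res x := fun a x => Scheme.Modules.map_smul _ _ _ _
  let l : Γ(M, U) →ₗ[Γ(X, U)] Γ((Scheme.Modules.pushforward f).obj K, U.1) :=
    { (res'.symm.toAddMonoidHom.comp ε.toAddEquiv.toAddMonoidHom).comp g with
      map_smul' := fun a m => by
        apply hres.1
        refine (res'.apply_symm_apply _).trans ?_
        refine Eq.trans ?_ (res_smul _ _).symm
        refine Eq.trans ?_ (congrArg _ (res'.apply_symm_apply _).symm)
        exact (congrArg ε (hg a m)).trans (ε.map_smul _ _) }
  have hl : ∀ m, res (l m) = ε (g m) := fun m => res'.apply_symm_apply _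
  obtain ⟨φ, hφ, hφu⟩ := existsUnique_hom_of_iso U.2.fromSpec U hU M _ _ κ l
  obtain ⟨ψ, rfl⟩ := ((Scheme.Modules.pullbackPushforwardAdjunction f).homEquiv M K).surjective φ
  have := isIso_fromTildeΓ_restrict_pullback f M U W h
  refine ⟨ε.symm.toLinearMap ∘ₗ { (ψ.app W).hom with map_smul' := fun r x => ψ.app_smul r x },
    fun m => ?_, fun g' hg' => ?_⟩
  · change ε.symm (ψ.app W _) = _
    rw [LinearEquiv.symm_apply_eq, ← homEquiv_app_res, hφ]
    exact hl m
  -- Uniqueness: as `f^*M` is quasi-coherent on `W`, a competing linear map `g'` also comes from a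
  -- sheaf morphism, whose adjoint agrees with that of `ψ` on `U`.
  · obtain ⟨ψ', hψ', -⟩ := existsUnique_hom_of_iso W.2.fromSpec W hW
      ((Scheme.Modules.pullback f).obj M) K T (Iso.refl _) (ε.toLinearMap ∘ₗ g')
    have : ψ' = ψ := by
      apply ((Scheme.Modules.pullbackPushforwardAdjunction f).homEquiv M K).injective
      apply hφu
      intro m
      apply hres.1
      refine (homEquiv_app_res f M K U W h ψ' m).trans ?_
      rw [hψ', hl]
      exact congrArg ε (hg' m)
    subst this
    ext x
    refine Eq.trans ?_ (congrArg ε.symm (hψ' x)).symm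
    exact (ε.symm_apply_apply _).symm

end

/-! ### Submodules under flat base change. -/

section

open TensorProduct

variable {A B M M' P P' : Type*} [CommRing A] [CommRing B] [AddCommGroup M] [AddCommGroup M']
  [Module A M] [Module B M'] [AddCommGroup P] [AddCommGroup P'] [Module A P] [Module B P']
  {φ : A →+* B} {ρ : M →+ M'} {σ : P →+ P'}

lemma IsBaseChangeAlong.comp_equiv {M'' : Type*} [AddCommGroup M''] [Module B M'']
    (h : IsBaseChangeAlong φ ρ) (e : M' ≃ₗ[B] M'') :
    IsBaseChangeAlong φ (e.toAddEquiv.toAddMonoidHom.comp ρ) where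
  map_smul a m := by
    change e (ρ (a • m)) = φ a • e (ρ m)
    rw [h.map_smul, _root_.map_smul]
  isBaseChange := by
    let := φ.toAlgebra
    let := Module.compHom M' φ
    have : IsScalarTower A B M' := ⟨fun a b m => mul_smul (φ a) b m⟩
    let := Module.compHom M'' φ
    have : IsScalarTower A B M'' := ⟨fun a b m => mul_smul (φ a) b m⟩
    exact IsBaseChange.of_equiv (h.isBaseChange.equiv.trans e)
      fun m => congrArg e ((h.isBaseChange.equiv_tmul 1 m).trans (one_smul _ _))

lemma isBaseChangeAlong_ringHom (φ : A →+* B) : IsBaseChangeAlong φ φ.toAddMonoidHom where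
  map_smul a m := φ.map_mul a m
  isBaseChange := by
    let := φ.toAlgebra
    exact IsBaseChange.linearMap A B

lemma isBaseChangeAlong_of_isBaseChange (φ : A →+* B) : letI := φ.toAlgebra
    ∀ [Module A M'] [IsScalarTower A B M'] (f : M →ₗ[A] M'), IsBaseChange B f →
      IsBaseChangeAlong φ f.toAddMonoidHom := by
  let := φ.toAlgebra
  intro inst _ f hf
  have hs : ∀ (a : A) (m : M'), a • m = φ a • m := fun a m => (algebraMap_smul B a m).symm
  obtain rfl : inst = Module.compHom M' φ := Module.ext' _ _ hs
  let := Module.compHom M' φ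
  exact ⟨fun a m => (f.map_smul a m).trans (hs _ _), hf⟩

lemma span_image_span (h : ∀ (a : A) (m : M), ρ (a • m) = φ a • ρ m) (s : Set M) :
    Submodule.span B (ρ '' (Submodule.span A s : Set M)) = Submodule.span B (ρ '' s) := by
  apply le_antisymm
  · rw [Submodule.span_le]
    rintro _ ⟨x, hx, rfl⟩
    induction hx using Submodule.span_induction with
    | mem x hx => exact Submodule.subset_span ⟨x, hx, rfl⟩
    | zero => simp
    | add x y _ _ hx hy =>
      rw [map_add]
      exact add_mem hx hy
    | smul a x _ hx =>
      rw [SetLike.mem_coe, h]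
      exact Submodule.smul_mem _ _ hx
  · exact Submodule.span_mono (Set.image_mono Submodule.subset_span)

lemma IsBaseChangeAlong.span_range (hρ : IsBaseChangeAlong φ ρ) :
    Submodule.span B (ρ '' Set.univ) = ⊤ := by
  let := φ.toAlgebra
  let := Module.compHom M' φ
  have : IsScalarTower A B M' := ⟨fun a b m => mul_smul (φ a) b m⟩
  refine eq_top_iff.2 fun x _ => ?_
  refine hρ.isBaseChange.inductionOn x (fun x => x ∈ _) (zero_mem _)
    (fun m => Submodule.subset_span ⟨m, trivial, rfl⟩)
    (fun b m hm => Submodule.smul_mem _ b hm) (fun _ _ => add_mem)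

lemma span_image_smul (h : ∀ (a : A) (m : M), ρ (a • m) = φ a • ρ m) (I : Ideal A)
    (N : Submodule A M) :
    Submodule.span B (ρ '' (I • N : Submodule A M)) =
      I.map φ • Submodule.span B (ρ '' (N : Set M)) := by
  apply le_antisymm
  · rw [Submodule.span_le]
    rintro _ ⟨x, hx, rfl⟩
    refine Submodule.smul_induction_on hx (fun a ha n hn => ?_) (fun x y hx hy => ?_)
    · rw [SetLike.mem_coe, h]
      exact Submodule.smul_mem_smul (Ideal.mem_map_of_mem _ ha)
        (Submodule.subset_span ⟨n, hn, rfl⟩)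
    · rw [map_add]
      exact add_mem hx hy
  · rw [Ideal.map, Ideal.span, Submodule.span_smul_span, Submodule.span_le]
    rintro _ ⟨_, ⟨a, ha, rfl⟩, _, ⟨n, hn, rfl⟩, rfl⟩
    exact Submodule.subset_span ⟨a • n, Submodule.smul_mem_smul ha hn, h a n⟩

lemma span_image_map (ρ : M →+ M') (σ : P →+ P') (u : M →ₗ[A] P) (v : M' →ₗ[B] P')
    (huv : ∀ m, v (ρ m) = σ (u m)) (N : Submodule A M) :
    Submodule.span B (σ '' (N.map u : Set P)) = (Submodule.span B (ρ '' (N : Set M))).map v := by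
  rw [Submodule.map_span, ← Set.image_comp, Submodule.map_coe, ← Set.image_comp]
  exact congrArg _ (Set.image_congr fun m _ => (huv m).symm)

/-- The preimage of `N` is the kernel of `M → P → P ⧸ N`, and flat base change preserves kernels. -/
lemma IsBaseChangeAlong.comap_span_image (hρ : IsBaseChangeAlong φ ρ) (hσ : IsBaseChangeAlong φ σ)
    (hφ : φ.Flat) (u : M →ₗ[A] P) (v : M' →ₗ[B] P') (huv : ∀ m, v (ρ m) = σ (u m))
    (N : Submodule A P) :
    (Submodule.span B (σ '' (N : Set P))).comap v =
      Submodule.span B (ρ '' (N.comap u : Set M)) := by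
  let := φ.toAlgebra
  let := Module.compHom M' φ
  have : IsScalarTower A B M' := ⟨fun a b m => mul_smul (φ a) b m⟩
  let := Module.compHom P' φ
  have : IsScalarTower A B P' := ⟨fun a b m => mul_smul (φ a) b m⟩
  have : Module.Flat A B := hφ
  apply le_antisymm
  · intro x hx
    let eM := hρ.isBaseChange.equiv
    let eP := hσ.isBaseChange.equiv
    have hM : ∀ b m, eM (b ⊗ₜ m) = b • ρ m := hρ.isBaseChange.equiv_tmul
    have hP : ∀ b m, eP (b ⊗ₜ m) = b • σ m := hσ.isBaseChange.equiv_tmul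
    have huv' : v ∘ₗ eM.toLinearMap = eP.toLinearMap ∘ₗ u.baseChange B := by
      ext m
      simp [hM, hP, huv]
    -- `w` is the base change of `P → P ⧸ N`; it kills the extension of `N`, which puts `x` in the
    -- kernel of the base-changed composite.
    let w : P' →ₗ[B] B ⊗[A] (P ⧸ N) := N.mkQ.baseChange B ∘ₗ eP.symm.toLinearMap
    have hw : ∀ y ∈ Submodule.span B (σ '' (N : Set P)), w y = 0 := by
      intro y hy
      refine (Submodule.span_le (p := LinearMap.ker w)).2 ?_ hy
      rintro _ ⟨n, hn, rfl⟩
      have : eP.symm (σ n) = 1 ⊗ₜ n := by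
        rw [LinearEquiv.symm_apply_eq, hP, one_smul]
      simp only [SetLike.mem_coe, LinearMap.mem_ker, w, LinearMap.comp_apply]
      refine (congrArg _ this).trans ?_
      have : N.mkQ n = 0 := (Submodule.Quotient.mk_eq_zero N).2 hn
      simp only [LinearMap.baseChange_tmul, this, tmul_zero]
    obtain ⟨x, rfl⟩ := eM.surjective x
    have h0 : (N.mkQ ∘ₗ u).lTensor B x = 0 := by
      have h1 := hw _ hx
      have h2 : v (eM x) = eP (u.baseChange B x) := congr($huv' x)
      simp only [w, LinearMap.comp_apply, h2] at h1
      rw [LinearMap.lTensor_comp]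
      refine Eq.trans ?_ h1
      change _ = LinearMap.baseChange B N.mkQ (eP.symm (eP _))
      rw [eP.symm_apply_apply]
      rfl
    have hex := Module.Flat.lTensor_exact B
      (LinearMap.exact_subtype_ker_map (N.mkQ ∘ₗ u))
    obtain ⟨y, rfl⟩ := (hex x).1 h0
    clear hx h0
    induction y using TensorProduct.induction_on with
    | zero => simp
    | tmul b k =>
      rw [LinearMap.lTensor_tmul, hM]
      refine Submodule.smul_mem _ _ (Submodule.subset_span ⟨_, ?_, rfl⟩)
      have := k.2
      rw [LinearMap.mem_ker, LinearMap.comp_apply, Submodule.mkQ_apply,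
        Submodule.Quotient.mk_eq_zero] at this
      exact this
    | add y z hy hz => simpa only [map_add] using add_mem hy hz
  · rw [Submodule.span_le]
    rintro _ ⟨m, hm, rfl⟩
    exact (Submodule.mem_comap).2 ((huv m).symm ▸ Submodule.subset_span ⟨u m, hm, rfl⟩)

/-- `N₁ ⊓ N₂` is the preimage of `N₂` under the inclusion of `N₁`. -/
lemma IsBaseChangeAlong.span_image_inf (hρ : IsBaseChangeAlong φ ρ) (hφ : φ.Flat)
    (N₁ N₂ : Submodule A M) :
    Submodule.span B (ρ '' (N₁ ⊓ N₂ : Submodule A M)) =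
      Submodule.span B (ρ '' (N₁ : Set M)) ⊓ Submodule.span B (ρ '' (N₂ : Set M)) := by
  let := φ.toAlgebra
  let := Module.compHom M' φ
  have : IsScalarTower A B M' := ⟨fun a b m => mul_smul (φ a) b m⟩
  let τ : N₁ →ₗ[A] B ⊗[A] N₁ := TensorProduct.mk A B N₁ 1
  have hτ : IsBaseChangeAlong φ τ.toAddMonoidHom :=
    isBaseChangeAlong_of_isBaseChange φ τ (TensorProduct.isBaseChange A N₁ B)
  let v : B ⊗[A] N₁ →ₗ[B] M' := hρ.isBaseChange.equiv.toLinearMap ∘ₗ N₁.subtype.baseChange B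
  have hv : ∀ b n, v (b ⊗ₜ n) = b • ρ n := fun b n => hρ.isBaseChange.equiv_tmul b n.1
  have hr : Submodule.span B (ρ '' (N₁ : Set M)) ≤ LinearMap.range v := by
    rw [Submodule.span_le]
    rintro _ ⟨n, hn, rfl⟩
    exact ⟨1 ⊗ₜ ⟨n, hn⟩, (hv _ _).trans (one_smul _ _)⟩
  have hc := hτ.comap_span_image hρ hφ N₁.subtype v
    (fun m => (hv 1 m).trans (one_smul _ _)) N₂
  apply le_antisymm
  · exact le_inf (Submodule.span_mono (Set.image_mono fun x hx => hx.1))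
      (Submodule.span_mono (Set.image_mono fun x hx => hx.2))
  · rintro x ⟨hx1, hx2⟩
    obtain ⟨y, rfl⟩ := hr hx1
    have hy : y ∈ Submodule.comap v (Submodule.span B (ρ '' (N₂ : Set M))) := hx2
    rw [hc] at hy
    have := Submodule.mem_map_of_mem (f := v) hy
    rw [Submodule.map_span] at this
    refine Submodule.span_le.2 ?_ this
    rintro _ ⟨_, ⟨n, hn, rfl⟩, rfl⟩
    exact Submodule.subset_span ⟨n, ⟨n.2, hn⟩, ((hv 1 n).trans (one_smul _ _)).symm⟩

/-- Finite generation of `L` makes the colon a finite intersection of ideals `N : a`, each the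
preimage of `N` under `r ↦ r • a`. -/
lemma IsBaseChangeAlong.map_colon (hρ : IsBaseChangeAlong φ ρ) (hφ : φ.Flat)
    (N L : Submodule A M) (hL : L.FG) :
    (N.colon (L : Set M)).map φ = (Submodule.span B (ρ '' (N : Set M))).colon
      (Submodule.span B (ρ '' (L : Set M)) : Set M') := by
  classical
  have key : ∀ s : Finset M, (N.colon (s : Set M)).map φ =
      (Submodule.span B (ρ '' (N : Set M))).colon (ρ '' (s : Set M)) := by
    intro s
    induction s using Finset.induction_on with
    | empty => simp [Ideal.map_top]
    | insert a s _ ih =>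
      have h1 : N.colon ({a} : Set M) = N.comap (LinearMap.toSpanSingleton A M a) := by
        ext r
        simp [Submodule.mem_colon_singleton]
      have h2 : (Submodule.span B (ρ '' (N : Set M))).colon {ρ a} =
          (Submodule.span B (ρ '' (N : Set M))).comap (LinearMap.toSpanSingleton B M' (ρ a)) := by
        ext r
        simp [Submodule.mem_colon_singleton]
      rw [Finset.coe_insert, Set.insert_eq, Submodule.colon_union, Set.image_union,
        Submodule.colon_union, Set.image_singleton, ← ih]
      refine ((isBaseChangeAlong_ringHom φ).span_image_inf hφ _ _).trans ?_
      refine congrArg₂ _ ?_ rfl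
      rw [h1, h2]
      exact ((isBaseChangeAlong_ringHom φ).comap_span_image hρ hφ _ _
        (fun m => (hρ.map_smul m a).symm) N).symm
  obtain ⟨s, rfl⟩ := hL
  rw [Submodule.colon_span, key s, span_image_span hρ.map_smul, Submodule.colon_span]

end

/-! ### Flatness of the action map. -/

section

-- The shear `(g, x) ↦ (g, g x)` has inverse `(g, x) ↦ (g, g⁻¹ x)`. It transports flatness from `p₂`
-- to `a`.
open scoped MonObj in
lemma isIso_lift_fst_smul {C : Type*} [Category* C] [CartesianMonoidalCategory C] (G X : C)
    [GrpObj G] [ModObj G X] :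
    IsIso (lift (fst G X) (ModObj.smul (M := G) (X := X) : G ⊗ X ⟶ X)) := by
  let g : G ⊗ X ⟶ G := fst G X
  let x : G ⊗ X ⟶ X := snd G X
  have hx : (ModObj.smul (M := G) (X := X) : G ⊗ X ⟶ X) = g • x := by
    simp [Hom.smul_def, g, x]
  rw [hx]
  have h1 : lift g (g • x) ≫ g = g := lift_fst _ _
  have h2 : lift g (g • x) ≫ x = g • x := lift_snd _ _
  have h3 : lift g (g⁻¹ • x) ≫ g = g := lift_fst _ _
  have h4 : lift g (g⁻¹ • x) ≫ x = g⁻¹ • x := lift_snd _ _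
  refine ⟨lift g (g⁻¹ • x), ?_, ?_⟩
  · rw [comp_lift, ModObj.comp_smul, h2, h1, GrpObj.comp_inv, h1, inv_smul_smul]
    exact lift_fst_snd
  · rw [comp_lift, ModObj.comp_smul, h4, h3, smul_inv_smul]
    exact lift_fst_snd

variable {S : Scheme.{u}} (G X : Over S) [GrpObj G] [ModObj G X]

instance flat_act [Flat (proj G X)] : Flat (act G X) := by
  have := isIso_lift_fst_smul G X
  have h : act G X = (lift (fst G X) (ModObj.smul (M := G) (X := X) : G ⊗ X ⟶ X)).left ≫
      proj G X := by
    rw [proj, ← Over.comp_left, lift_snd]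
    rfl
  rw [h]
  have : IsIso (lift (fst G X) (ModObj.smul (M := G) (X := X) : G ⊗ X ⟶ X)).left :=
    inferInstanceAs (IsIso ((Over.forget S).map (lift (fst G X) (ModObj.smul (M := G) (X := X)))))
  exact Flat.comp _ _

end

/-! ### Restriction of sections and pullback of ideals on affine opens. -/

section

variable {X Y : Scheme.{u}}

lemma pullbackSection_id_comp (M : X.Modules) (U W : X.Opens) (h : W ≤ U) (m : Γ(M, U)) :
    ((Scheme.Modules.pullbackId X).hom.app M).app W (pullbackSection (𝟙 X) M U W h m) =
      M.presheaf.map (homOfLE h).op m := by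
  have h1 := unit_conjugateEquiv .id (Scheme.Modules.pullbackPushforwardAdjunction (𝟙 X))
    (Scheme.Modules.pullbackId X).hom M
  rw [Scheme.Modules.conjugateEquiv_pullbackId_hom] at h1
  have h2 := congr(Scheme.Modules.Hom.app $h1 U m)
  have h3 := ((Scheme.Modules.pullbackId X).hom.app M).mapPresheaf.naturality (homOfLE h).op
  refine (congr($h3
    (((Scheme.Modules.pullbackPushforwardAdjunction (𝟙 X)).unit.app M).app U m))).trans ?_
  exact congrArg (M.presheaf.map (homOfLE h).op) h2.symm

/-- The case `f = 𝟙 X` of the pullback theorem. -/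
theorem isBaseChangeAlong_presheaf_map (M : X.Modules) [M.IsQuasicoherent]
    {U W : X.affineOpens} (h : W.1 ≤ U.1) :
    IsBaseChangeAlong (X.presheaf.map (homOfLE h).op).hom (M.presheaf.map (homOfLE h).op).hom := by
  have h1 := isBaseChangeAlong_pullbackSection (𝟙 X) M U W h
  have h0 : Scheme.Hom.appLE (𝟙 X) U.1 W.1 h = X.presheaf.map (homOfLE h).op :=
    Category.id_comp _
  rw [h0] at h1
  let e : Γ((Scheme.Modules.pullback (𝟙 X)).obj M, W.1) ≃ₗ[Γ(X, W)] Γ(M, W.1) :=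
    LinearEquiv.ofBijective
      { (((Scheme.Modules.pullbackId X).hom.app M).app W).hom with
        map_smul' := fun r x => ((Scheme.Modules.pullbackId X).hom.app M).app_smul r x }
      (ConcreteCategory.bijective_of_isIso (((Scheme.Modules.pullbackId X).hom.app M).app W))
  have h2 := h1.comp_equiv e
  have h3 : e.toAddEquiv.toAddMonoidHom.comp (pullbackSection (𝟙 X) M U W h) =
      (M.presheaf.map (homOfLE h).op).hom :=
    AddMonoidHom.ext fun m => pullbackSection_id_comp M U W h m
  rwa [h3] at h2

/-- For `≤`, the ideal sheaf generated by the extended ideal is compared with `I.comap g` through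
the adjunction of `comap` and `map`. -/
lemma ideal_comap_of_isAffine [IsAffine X] [IsAffine Y] (I : X.IdealSheafData) (g : Y ⟶ X) :
    (I.comap g).ideal ⟨⊤, isAffineOpen_top Y⟩ =
      (I.ideal ⟨⊤, isAffineOpen_top X⟩).map g.appTop.hom := by
  apply le_antisymm
  · let J : Y.IdealSheafData := Scheme.IdealSheafData.equivOfIsAffine.symm
      ((I.ideal ⟨⊤, isAffineOpen_top X⟩).map g.appTop.hom)
    have hJ : J.ideal ⟨⊤, isAffineOpen_top Y⟩ =
        (I.ideal ⟨⊤, isAffineOpen_top X⟩).map g.appTop.hom :=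
      Scheme.IdealSheafData.equivOfIsAffine.apply_symm_apply _
    have : I.comap g ≤ J := by
      rw [← Scheme.IdealSheafData.le_map_iff_comap_le]
      apply Scheme.IdealSheafData.le_of_isAffine
      rw [Scheme.IdealSheafData.ideal_map_of_isAffineHom]
      refine Ideal.map_le_iff_le_comap.1 ?_
      exact hJ.ge
    rw [← hJ]
    exact this _
  · rw [Ideal.map_le_iff_le_comap]
    have := Scheme.IdealSheafData.le_map_comap I g ⟨⊤, isAffineOpen_top X⟩
    rwa [Scheme.IdealSheafData.ideal_map_of_isAffineHom] at this

lemma ideal_comap (I : X.IdealSheafData) (f : Y ⟶ X) (U : X.affineOpens) (W : Y.affineOpens)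
    (h : W.1 ≤ f ⁻¹ᵁ U.1) :
    (I.comap f).ideal W = (I.ideal U).map (f.appLE U W h).hom := by
  have e : Spec.map (f.appLE U W h) ≫ U.2.fromSpec = W.2.fromSpec ≫ f :=
    U.2.SpecMap_appLE_fromSpec f W.2 h
  -- Both sides are transported to spectra: restricting an ideal sheaf to an affine open only
  -- changes its ideal by the isomorphism `Γ(Spec A) ≅ A`, cancelled in `h5`.
  have key : ∀ {Z : Scheme.{u}} (J : Z.IdealSheafData) (V : Z.affineOpens),
      (J.comap V.2.fromSpec).ideal ⟨⊤, isAffineOpen_top _⟩ =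
        (J.ideal V).map (Scheme.ΓSpecIso Γ(Z, V)).inv.hom := by
    intro Z J V
    have hV : V.2.fromSpec ''ᵁ ⊤ = V.1 := by
      rw [Scheme.Hom.image_top_eq_opensRange, V.2.opensRange_fromSpec]
    have e1 : (⊤ : (Spec Γ(Z, V)).Opens) ≤ V.2.fromSpec ⁻¹ᵁ V.1 :=
      V.2.fromSpec_preimage_self.ge
    have e2 : V.2.fromSpec.appLE V.1 ⊤ e1 = (Scheme.ΓSpecIso Γ(Z, V)).inv := by
      rw [Scheme.Hom.appLE, V.2.fromSpec_app_self, Category.assoc, ← Functor.map_comp]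
      exact (congrArg (_ ≫ ·) ((Spec Γ(Z, V)).presheaf.map_id _)).trans (Category.comp_id _)
    have e3 := V.2.fromSpec.appLE_appIso_inv e1
    rw [e2, Iso.comp_inv_eq] at e3
    have e4 : (J.ideal V).map (Z.presheaf.map (homOfLE hV.le).op).hom =
        J.ideal ⟨_, (isAffineOpen_top _).image_of_isOpenImmersion V.2.fromSpec⟩ :=
      J.map_ideal (U := ⟨_, (isAffineOpen_top _).image_of_isOpenImmersion V.2.fromSpec⟩) hV.le
    rw [Scheme.IdealSheafData.ideal_comap_of_isOpenImmersion, e3, CommRingCat.hom_comp,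
      ← Ideal.map_map]
    refine Eq.trans ?_ (congrArg _ e4.symm)
    exact (Ideal.map_comap_of_equiv
      (V.2.fromSpec.appIso ⊤).commRingCatIsoToRingEquiv).symm
  have h1 : (I.comap f).comap W.2.fromSpec =
      (I.comap U.2.fromSpec).comap (Spec.map (f.appLE U W h)) := by
    rw [← Scheme.IdealSheafData.comap_comp, ← Scheme.IdealSheafData.comap_comp, e]
  have h2 := congr(($h1).ideal ⟨⊤, isAffineOpen_top _⟩)
  rw [key, ideal_comap_of_isAffine, key, Ideal.map_map] at h2
  have h3 := Scheme.ΓSpecIso_inv_naturality (f.appLE U W h)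
  have h4 : (Spec.map (f.appLE U W h)).appTop.hom.comp (Scheme.ΓSpecIso Γ(X, U)).inv.hom =
      (Scheme.ΓSpecIso Γ(Y, W)).inv.hom.comp (f.appLE U W h).hom := congr(($h3).hom).symm
  rw [h4, ← Ideal.map_map] at h2
  have h5 : Function.Injective (Ideal.map (Scheme.ΓSpecIso Γ(Y, W)).inv.hom) := by
    refine Function.LeftInverse.injective
      (g := Ideal.map (Scheme.ΓSpecIso Γ(Y, W)).hom.hom) fun K => ?_
    rw [Ideal.map_map, ← CommRingCat.hom_comp, Iso.inv_hom_id]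
    exact Ideal.map_id K
  exact h5 h2

end

/-! ### Surjectivity and finite generation of sections over affine opens. -/

section

/-- Up to the counit isomorphisms `L.map (H.map π)` is `π`, and a faithful functor reflects
epimorphisms. -/
lemma epi_map_of_isIso_counit {C D : Type*} [Category* C] [Category* D] {L : C ⥤ D}
    {H : D ⥤ C} (adj : L ⊣ H) [L.Faithful] {P P' : D} [IsIso (adj.counit.app P)]
    [IsIso (adj.counit.app P')] (π : P ⟶ P') [Epi π] : Epi (H.map π) := by
  have h : L.map (H.map π) = adj.counit.app P ≫ π ≫ inv (adj.counit.app P') := by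
    rw [← Category.assoc, IsIso.eq_comp_inv]
    exact adj.counit.naturality π
  have : Epi (L.map (H.map π)) := by
    rw [h]
    infer_instance
  exact L.epi_of_epi_map this

variable {X : Scheme.{u}}

lemma surjective_app_top_of_epi {R : CommRingCat.{u}} {P P' : (Spec R).Modules}
    [IsIso P.fromTildeΓ] [IsIso P'.fromTildeΓ] (π : P ⟶ P') [Epi π] :
    Function.Surjective (π.app ⊤) := by
  have h1 : IsIso ((tilde.adjunction (R := R)).counit.app P) :=
    inferInstanceAs (IsIso P.fromTildeΓ)
  have h2 : IsIso ((tilde.adjunction (R := R)).counit.app P') :=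
    inferInstanceAs (IsIso P'.fromTildeΓ)
  have h3 : Epi (moduleSpecΓFunctor.map π) := epi_map_of_isIso_counit tilde.adjunction π
  have h4 := (ModuleCat.epi_iff_surjective (moduleSpecΓFunctor.map π)).1 h3
  exact h4

lemma surjective_app_of_epi {M K : X.Modules} [M.IsQuasicoherent] [K.IsQuasicoherent]
    (π : M ⟶ K) [Epi π] (U : X.affineOpens) : Function.Surjective (π.app U) := by
  have h := surjective_app_top_of_epi ((Scheme.Modules.restrictFunctor U.2.fromSpec).map π)
  have hU : U.2.fromSpec ''ᵁ ⊤ = U.1 := by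
    rw [Scheme.Hom.image_top_eq_opensRange, U.2.opensRange_fromSpec]
  have h' : Function.Surjective (π.app (U.2.fromSpec ''ᵁ ⊤)) := h
  rw [hU] at h'
  exact h'

lemma finite_top_of_generatingSections {R : CommRingCat.{u}} {P : (Spec R).Modules}
    [IsIso P.fromTildeΓ] (σ : SheafOfModules.GeneratingSections P) [Finite σ.I] :
    Module.Finite R Γ(P, ⊤) := by
  let π : tilde (ModuleCat.of R (σ.I →₀ R)) ⟶ P := (tildeFinsupp (R := R) σ.I).hom ≫ σ.π
  have h1 : Epi σ.π := σ.epi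
  have h2 : IsIso (tildeFinsupp (R := R) σ.I).hom := Iso.isIso_hom (tildeFinsupp (R := R) σ.I)
  have : Epi π := epi_comp' (IsIso.epi_of_iso _) h1
  have hs := surjective_app_top_of_epi π
  let l : Γ(tilde (ModuleCat.of R (σ.I →₀ R)), ⊤) →ₗ[R] Γ(P, ⊤) :=
    (moduleSpecΓFunctor.map π).hom
  let l' : (σ.I →₀ R) →ₗ[R] Γ(tilde (ModuleCat.of R (σ.I →₀ R)), ⊤) :=
    (tilde.isoTop (ModuleCat.of R (σ.I →₀ R))).hom.hom
  have hl' : Function.Surjective l' := (ConcreteCategory.bijective_of_isIso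
    (tilde.isoTop (ModuleCat.of R (σ.I →₀ R))).hom).2
  exact Module.Finite.of_surjective (l ∘ₗ l') (hs.comp hl')

lemma finite_sections_of_finite_restrict {R : CommRingCat.{u}} (i : Spec R ⟶ X)
    [IsOpenImmersion i] (U : X.Opens) (hU : i ''ᵁ ⊤ = U) (M : X.Modules)
    [h : Module.Finite R Γ(M.restrict i, ⊤)] : Module.Finite Γ(X, U) Γ(M, U) := by
  subst hU
  obtain ⟨s, hs⟩ := h
  have key : ∀ x ∈ Submodule.span R (s : Set Γ(M.restrict i, ⊤)),
      (M.restrictAppIso i ⊤).hom x ∈ Submodule.span Γ(X, i ''ᵁ ⊤)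
        ((M.restrictAppIso i ⊤).hom '' s) := fun x hx => ?_
  · classical
    refine ⟨⟨s.image (M.restrictAppIso i ⊤).hom, eq_top_iff.2 fun x _ => ?_⟩⟩
    rw [Finset.coe_image]
    exact key x (hs.ge trivial)
  induction hx using Submodule.span_induction with
  | mem x hx => exact Submodule.subset_span ⟨x, hx, rfl⟩
  | zero => simp
  | add x y _ _ hx hy => exact add_mem hx hy
  | smul r x _ hx =>
    exact Submodule.smul_mem _ ((i.appIso ⊤).inv
      ((Spec R).presheaf.map (TopologicalSpace.Opens.leTop ⊤).op ((Scheme.ΓSpecIso R).inv r)))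
      hx

lemma finite_sections_of_le (M : X.Modules) [M.IsQuasicoherent]
    (V : X.Opens) (σ : SheafOfModules.GeneratingSections (SheafOfModules.over M V)) [Finite σ.I]
    (W : X.affineOpens) (h : W.1 ≤ V) : Module.Finite Γ(X, W) Γ(M, W) := by
  let u := X.homOfLE h
  let j : Spec Γ(X, W) ⟶ W.1.toScheme := W.2.isoSpec.inv
  let F := (Scheme.Modules.overEquiv V).functor ⋙ Scheme.Modules.restrictFunctor (j ≫ u)
  let iso : SheafOfModules.overFunctor X.ringCatSheaf _ ⋙ F ≅
      Scheme.Modules.restrictFunctor (IsAffineOpen.fromSpec W.2) :=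
    (Functor.associator _ _ _).symm ≪≫
      Functor.isoWhiskerRight (Scheme.Modules.overFunctorEquiv _) _ ≪≫
      (Scheme.Modules.restrictFunctorComp _ _).symm ≪≫
      Scheme.Modules.restrictFunctorCongr (by simp [u, j]; rfl)
  have : Limits.PreservesColimitsOfSize.{u, u} (Scheme.Modules.restrictFunctor (j ≫ u)) :=
    inferInstance
  have hF : Limits.PreservesColimitsOfSize.{u, u} F := Limits.comp_preservesColimits _ _
  let F' : SheafOfModules.{u} (X.ringCatSheaf.over V) ⥤
    SheafOfModules.{u} (Spec Γ(X, W)).ringCatSheaf := F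
  have hF' : Limits.PreservesColimitsOfSize.{u, u} F' := hF
  let K : SheafOfModules.{u} (Spec Γ(X, W)).ringCatSheaf := M.restrict W.2.fromSpec
  let ψ : F'.obj (SheafOfModules.over M V) ⟶ K := (iso.app M).hom
  have hψ : Epi (iso.app M).hom := inferInstance
  have hψ' : Epi ψ := hψ
  let τ := (σ.map F' (Scheme.Modules.restrictUnitIso _).symm).ofEpi ψ
  have : Finite τ.I := inferInstanceAs (Finite σ.I)
  have := finite_top_of_generatingSections τ
  exact finite_sections_of_finite_restrict W.2.fromSpec W.1 (by
    rw [Scheme.Hom.image_top_eq_opensRange, W.2.opensRange_fromSpec]) M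

lemma exists_finite_sections_basicOpen (M : X.Modules) [M.IsQuasicoherent]
    (hM : M.IsFiniteType) (U : X.affineOpens) (x : X) (hx : x ∈ U.1) :
    ∃ f : Γ(X, U), x ∈ X.basicOpen f ∧
      Module.Finite Γ(X, X.basicOpen f) Γ(M, X.basicOpen f) := by
  obtain ⟨σ, hσ⟩ := hM.exists_localGeneratorsData
  obtain ⟨V, i, ⟨k, ⟨hk⟩⟩, hxV⟩ := σ.coversTop U.1 x hx
  obtain ⟨f, hf, hxf⟩ := U.2.exists_basicOpen_le ⟨x, hxV⟩ hx
  have := (hσ.isFiniteType k).finite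
  exact ⟨f, hxf, finite_sections_of_le M (σ.X k) (σ.generators k) (X.affineBasicOpen f)
    (hf.trans (leOfHom hk))⟩

/-- Local generators give finiteness on a distinguished cover of `U`, and finiteness of a module
descends from such a cover. -/
theorem finite_sections (M : X.Modules) [M.IsQuasicoherent]
    (hM : M.IsFiniteType) (U : X.affineOpens) : Module.Finite Γ(X, U) Γ(M, U) := by
  choose f hf hfin using fun x : U.1 => exists_finite_sections_basicOpen M hM U x.1 x.2
  have hspan : Ideal.span (Set.range f) = ⊤ := by
    rw [← U.2.self_le_iSup_basicOpen_iff]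
    intro x hx
    exact TopologicalSpace.Opens.mem_iSup.2 ⟨⟨_, ⟨x, hx⟩, rfl⟩, hf ⟨x, hx⟩⟩
  let alg (g : Set.range f) : Algebra Γ(X, U) Γ(X, X.basicOpen g.1) :=
    (X.presheaf.map (homOfLE (X.basicOpen_le g.1)).op).hom.toAlgebra
  let mod (g : Set.range f) : Module Γ(X, U) Γ(M, X.basicOpen g.1) :=
    Module.compHom _ (X.presheaf.map (homOfLE (X.basicOpen_le g.1)).op).hom
  have tower (g : Set.range f) :
      IsScalarTower Γ(X, U) Γ(X, X.basicOpen g.1) Γ(M, X.basicOpen g.1) :=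
    ⟨fun a b m => mul_smul (X.presheaf.map (homOfLE (X.basicOpen_le g.1)).op a) b m⟩
  have loc (g : Set.range f) : IsLocalization.Away g.1 Γ(X, X.basicOpen g.1) :=
    U.2.isLocalization_basicOpen g.1
  have hb (g : Set.range f) :
      IsBaseChangeAlong (X.presheaf.map (homOfLE (X.basicOpen_le g.1)).op).hom
        (M.presheaf.map (homOfLE (X.basicOpen_le g.1)).op).hom :=
    isBaseChangeAlong_presheaf_map M (U := U) (W := X.affineBasicOpen g.1) (X.basicOpen_le g.1)
  let l (g : Set.range f) : Γ(M, U) →ₗ[Γ(X, U)] Γ(M, X.basicOpen g.1) :=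
    { (M.presheaf.map (homOfLE (X.basicOpen_le g.1)).op).hom with
      map_smul' := (hb g).map_smul }
  have hl (g : Set.range f) : IsLocalizedModule.Away g.1 (l g) :=
    (isLocalizedModule_iff_isBaseChange (.powers g.1) Γ(X, X.basicOpen g.1) (l g)).2
      (hb g).isBaseChange
  exact Module.Finite.of_localizationSpan' (Set.range f) hspan
    (Rₚ := fun g => Γ(X, X.basicOpen g.1)) l (by rintro ⟨_, x, rfl⟩; exact hfin x)

end

/-! ### Local description of colon ideals. -/

section

variable {X Y : Scheme.{u}}

/-- The map on sections over `U` induced by a morphism of `𝒪_X`-modules, as a linear map. -/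
def appLinear {M K : X.Modules} (π : M ⟶ K) (U : X.Opens) : Γ(M, U) →ₗ[Γ(X, U)] Γ(K, U) :=
  { (π.app U).hom with map_smul' := fun r x => π.app_smul r x }

/-- The map on sections over `U` induced by an isomorphism of `𝒪_X`-modules, as a linear
equivalence. -/
def appEquiv {M K : X.Modules} (e : M ≅ K) (U : X.Opens) : Γ(M, U) ≃ₗ[Γ(X, U)] Γ(K, U) :=
  LinearEquiv.ofBijective (appLinear e.hom U)
    (ConcreteCategory.bijective_of_isIso (e.hom.app U))

lemma flat_presheaf_map {U W : X.affineOpens} (h : W.1 ≤ U.1) :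
    (X.presheaf.map (homOfLE h).op).hom.Flat := by
  have h1 := Scheme.Hom.flat_appLE (𝟙 X) U.2 W.2 h
  have h0 : Scheme.Hom.appLE (𝟙 X) U.1 W.1 h = X.presheaf.map (homOfLE h).op :=
    Category.id_comp _
  rwa [h0] at h1

lemma pullbackSection_naturality (f : Y ⟶ X) {M K : X.Modules} (π : M ⟶ K) (U : X.Opens)
    (W : Y.Opens) (h : W ≤ f ⁻¹ᵁ U) (m : Γ(M, U)) :
    ((Scheme.Modules.pullback f).map π).app W (pullbackSection f M U W h m) =
      pullbackSection f K U W h (π.app U m) := by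
  have h1 := (Scheme.Modules.pullbackPushforwardAdjunction f).unit.naturality π
  have h2 := congr(Scheme.Modules.Hom.app $h1 U m)
  have h3 := ((Scheme.Modules.pullback f).map π).mapPresheaf.naturality (homOfLE h).op
  refine (congr($h3
    (((Scheme.Modules.pullbackPushforwardAdjunction f).unit.app M).app U m))).trans ?_
  exact congrArg (((Scheme.Modules.pullback f).obj K).presheaf.map (homOfLE h).op) h2.symm

lemma isBaseChangeAlong_basicOpen (M : X.Modules) [M.IsQuasicoherent] (U : X.affineOpens)
    (f : Γ(X, U)) :
    IsBaseChangeAlong (X.presheaf.map (homOfLE (X.basicOpen_le f)).op).hom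
      (M.presheaf.map (homOfLE (X.basicOpen_le f)).op).hom :=
  isBaseChangeAlong_presheaf_map M (U := U) (W := X.affineBasicOpen f) (X.basicOpen_le f)

lemma flat_basicOpen (U : X.affineOpens) (f : Γ(X, U)) :
    (X.presheaf.map (homOfLE (X.basicOpen_le f)).op).hom.Flat :=
  flat_presheaf_map (U := U) (W := X.affineBasicOpen f) (X.basicOpen_le f)

/-- Localization is flat and `L` is finitely generated, so the local colons already form an ideal
sheaf and `ofIdeals` leaves them unchanged. -/
lemma colon_ideal {M : X.Modules} [M.IsQuasicoherent] (N L : CoherentSubmodule M)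
    (U : X.affineOpens) :
    (colon N.sections L.sections).ideal U = (N.sections U).colon (L.sections U : Set Γ(M, U)) := by
  let I : X.IdealSheafData :=
    { ideal := fun U => (N.sections U).colon (L.sections U : Set Γ(M, U))
      map_ideal_basicOpen := fun U f => by
        refine ((isBaseChangeAlong_basicOpen M U f).map_colon (flat_basicOpen U f) _ _
          (L.fg U)).trans ?_
        rw [← N.span_basicOpen U f, ← L.span_basicOpen U f]
        rfl }
  have h : colon N.sections L.sections = I := Scheme.IdealSheafData.ofIdeals_ideal I
  rw [h]

lemma le_colon_iff {M : X.Modules} [M.IsQuasicoherent] (N L : CoherentSubmodule M)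
    (P : X.IdealSheafData) :
    P ≤ colon N.sections L.sections ↔ ∀ U, P.ideal U • L.sections U ≤ N.sections U := by
  refine forall_congr' fun U => ?_
  rw [colon_ideal]
  constructor
  · exact fun h => Submodule.smul_le.2 fun a ha m hm => Submodule.mem_colon.1 (h ha) m hm
  · exact fun h a ha => Submodule.mem_colon.2 fun m hm => h (Submodule.smul_mem_smul ha hm)

lemma isNoetherian_sections [IsLocallyNoetherian X] (M : X.Modules) [M.IsQuasicoherent]
    (hM : M.IsFiniteType) (U : X.affineOpens) : IsNoetherian Γ(X, U) Γ(M, U) := by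
  have := IsLocallyNoetherian.component_noetherian U
  have := finite_sections M hM U
  exact isNoetherian_of_isNoetherianRing_of_finite _ _

end

/-! ### Operations on equivariant submodules. -/

section

variable {S : Scheme.{u}} {G X : Over S} [GrpObj G] [ModObj G X]

lemma idealSheafData_ext_GX {I J : (GX G X).IdealSheafData}
    (h : ∀ (U V : X.left.affineOpens) (W : (GX G X).affineOpens), W.1 ≤ act G X ⁻¹ᵁ U.1 →
      W.1 ≤ proj G X ⁻¹ᵁ V.1 → I.ideal W = J.ideal W) : I = J := by
  have key : ∀ x : GX G X, ∃ W : (GX G X).affineOpens, x ∈ W.1 ∧ I.ideal W = J.ideal W := by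
    intro x
    obtain ⟨U, hU, hxU, -⟩ := exists_isAffineOpen_mem_and_subset
      (x := act G X x) (U := ⊤) trivial
    obtain ⟨V, hV, hxV, -⟩ := exists_isAffineOpen_mem_and_subset
      (x := proj G X x) (U := ⊤) trivial
    obtain ⟨W, hW, hxW, hWU⟩ := exists_isAffineOpen_mem_and_subset
      (x := x) (U := act G X ⁻¹ᵁ U ⊓ proj G X ⁻¹ᵁ V) ⟨hxU, hxV⟩
    exact ⟨⟨W, hW⟩, hxW, h ⟨U, hU⟩ ⟨V, hV⟩ ⟨W, hW⟩ (fun y hy => (hWU hy).1)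
      (fun y hy => (hWU hy).2)⟩
  choose W hxW hW using key
  exact Scheme.IdealSheafData.ext_of_iSup_eq_top W
    (eq_top_iff.2 fun x _ => TopologicalSpace.Opens.mem_iSup.2 ⟨x, hxW x⟩) hW

variable {M : CoherentGModule G X}

instance : M.carrier.IsQuasicoherent := M.isQuasicoherent

lemma pullbackSections_map_of_image_eq {N : CoherentSubmodule M.carrier}
    (h : ∀ (U V : X.left.affineOpens) (W : (GX G X).affineOpens)
      (hU : W.1 ≤ act G X ⁻¹ᵁ U.1) (hV : W.1 ≤ proj G X ⁻¹ᵁ V.1),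
      (N.pullbackSections (act G X) U W hU).map (appEquiv M.lin W.1).toLinearMap =
        N.pullbackSections (proj G X) V W hV)
    (U V : X.left.affineOpens) (W : (GX G X).affineOpens)
    (hU : W.1 ≤ act G X ⁻¹ᵁ U.1) (hV : W.1 ≤ proj G X ⁻¹ᵁ V.1) :
    (fun x => M.lin.hom.app W x) ''
      (N.pullbackSections (act G X) U W hU :
        Set Γ((Scheme.Modules.pullback (act G X)).obj M.carrier, W)) =
      (N.pullbackSections (proj G X) V W hV :
        Set Γ((Scheme.Modules.pullback (proj G X)).obj M.carrier, W)) :=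
  congrArg SetLike.coe (h U V W hU hV)

lemma GSubmodule.map_lin (N : GSubmodule M) (U V : X.left.affineOpens) (W : (GX G X).affineOpens)
    (hU : W.1 ≤ act G X ⁻¹ᵁ U.1) (hV : W.1 ≤ proj G X ⁻¹ᵁ V.1) :
    (N.pullbackSections (act G X) U W hU).map (appEquiv M.lin W.1).toLinearMap =
      N.pullbackSections (proj G X) V W hV :=
  SetLike.coe_injective (N.equivariant U V W hU hV)

lemma IsGIdeal.map_eq {I : X.left.IdealSheafData} (hI : IsGIdeal G I) (U V : X.left.affineOpens)
    (W : (GX G X).affineOpens) (hU : W.1 ≤ act G X ⁻¹ᵁ U.1) (hV : W.1 ≤ proj G X ⁻¹ᵁ V.1) :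
    (I.ideal U).map ((act G X).appLE U W hU).hom =
      (I.ideal V).map ((proj G X).appLE V W hV).hom := by
  rw [← ideal_comap, ← ideal_comap, hI]

lemma isGIdeal_of_map_eq {I : X.left.IdealSheafData} (h : ∀ (U V : X.left.affineOpens)
    (W : (GX G X).affineOpens) (hU : W.1 ≤ act G X ⁻¹ᵁ U.1) (hV : W.1 ≤ proj G X ⁻¹ᵁ V.1),
    (I.ideal U).map ((act G X).appLE U W hU).hom =
      (I.ideal V).map ((proj G X).appLE V W hV).hom) : IsGIdeal G I :=
  idealSheafData_ext_GX fun U V W hU hV => by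
    rw [ideal_comap I _ U W hU, ideal_comap I _ V W hV, h]

namespace GSubmodule

variable [IsLocallyNoetherian X.left]

lemma fg_of_isLocallyNoetherian (U : X.left.affineOpens) (N : Submodule Γ(X.left, U)
    Γ(M.carrier, U)) : N.FG := by
  have := isNoetherian_sections M.carrier M.isFiniteType U
  exact IsNoetherian.noetherian N

instance : Top (GSubmodule M) where
  top :=
    { sections := fun _ => ⊤
      span_basicOpen := fun U f => (isBaseChangeAlong_basicOpen M.carrier U f).span_range
      fg := fun U => fg_of_isLocallyNoetherian U _
      equivariant := pullbackSections_map_of_image_eq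
        (N := ⟨fun _ => ⊤, _, fun U => fg_of_isLocallyNoetherian U _⟩) fun U V W hU hV => by
        have h1 : Submodule.span _ (pullbackSection (act G X) M.carrier U W hU '' Set.univ) = ⊤ :=
          (isBaseChangeAlong_pullbackSection (act G X) M.carrier U W hU).span_range
        have h2 : Submodule.span _ (pullbackSection (proj G X) M.carrier V W hV '' Set.univ) = ⊤ :=
          (isBaseChangeAlong_pullbackSection (proj G X) M.carrier V W hV).span_range
        refine Eq.trans (congrArg _ h1) (Eq.trans ?_ h2.symm)
        rw [Submodule.map_top]
        exact (appEquiv M.lin W.1).range }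

@[simp]
lemma top_sections (U : X.left.affineOpens) : (⊤ : GSubmodule M).sections U = ⊤ := rfl

/-- The product `I L` of a `G`-ideal `I` and a `(G, 𝒪_X)`-submodule `L`. -/
def smul (I : X.left.IdealSheafData) (hI : IsGIdeal G I) (L : GSubmodule M) : GSubmodule M where
  sections U := I.ideal U • L.sections U
  span_basicOpen U f := by
    refine (span_image_smul (isBaseChangeAlong_basicOpen M.carrier U f).map_smul _ _).trans ?_
    rw [I.map_ideal_basicOpen]
    exact congrArg _ (L.span_basicOpen U f)
  fg U := fg_of_isLocallyNoetherian U _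
  equivariant := pullbackSections_map_of_image_eq
      (N := ⟨fun U => I.ideal U • L.sections U, _, fun U => fg_of_isLocallyNoetherian U _⟩)
      fun U V W hU hV => by
    refine Eq.trans (congrArg _ (span_image_smul (pullbackSection_smul (act G X) M.carrier U W hU)
      _ _)) (Eq.trans ?_ (span_image_smul (pullbackSection_smul (proj G X) M.carrier V W hV)
      _ _).symm)
    rw [Submodule.map_smul'', hI.map_eq U V W hU hV]
    exact congrArg _ (L.map_lin U V W hU hV)

variable {K : CoherentGModule G X}

/-- The image of a `(G, 𝒪_X)`-submodule under a `(G, 𝒪_X)`-linear map. -/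
def map (π : M.carrier ⟶ K.carrier) (hπ : IsEquivariant π) (L : GSubmodule M) :
    GSubmodule K where
  sections U := (L.sections U).map (appLinear π U)
  span_basicOpen U f := by
    refine (span_image_map (M.carrier.presheaf.map (homOfLE (X.left.basicOpen_le f)).op).hom
      (K.carrier.presheaf.map (homOfLE (X.left.basicOpen_le f)).op).hom (appLinear π U)
      (appLinear π (X.left.basicOpen f)) (fun m => ?_) _).trans ?_
    · exact congr($(π.mapPresheaf.naturality (homOfLE (X.left.basicOpen_le f)).op) m)
    · exact congrArg _ (L.span_basicOpen U f)
  fg U := fg_of_isLocallyNoetherian U _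
  equivariant := pullbackSections_map_of_image_eq
      (N := ⟨fun U => (L.sections U).map (appLinear π U), _,
        fun U => fg_of_isLocallyNoetherian U _⟩)
      fun U V W hU hV => by
    refine Eq.trans (congrArg _ (span_image_map _ _ (appLinear π U)
      (appLinear ((Scheme.Modules.pullback (act G X)).map π) W)
      (pullbackSection_naturality _ _ _ _ _) _)) (Eq.trans ?_
      (span_image_map _ _ (appLinear π V)
      (appLinear ((Scheme.Modules.pullback (proj G X)).map π) W)
      (pullbackSection_naturality _ _ _ _ _) _).symm)
    have h1 := L.map_lin U V W hU hV
    unfold CoherentSubmodule.pullbackSections at h1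
    rw [← h1, ← Submodule.map_comp, ← Submodule.map_comp]
    congr 1
    ext x
    exact congr(Scheme.Modules.Hom.app $hπ W x)

@[simp]
lemma map_sections (π : M.carrier ⟶ K.carrier) (hπ : IsEquivariant π) (L : GSubmodule M)
    (U : X.left.affineOpens) :
    (L.map π hπ).sections U = (L.sections U).map (appLinear π U) := rfl

variable [Flat (proj G X)]

/-- Here flatness of `a` and `p₂` enters: it lets both pullbacks commute with intersections. -/
instance : Min (GSubmodule M) where
  min N L :=
    { sections := fun U => N.sections U ⊓ L.sections U
      span_basicOpen := fun U f => by
        refine ((isBaseChangeAlong_basicOpen M.carrier U f).span_image_inf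
          (flat_basicOpen U f) _ _).trans ?_
        exact congrArg₂ _ (N.span_basicOpen U f) (L.span_basicOpen U f)
      fg := fun U => fg_of_isLocallyNoetherian U _
      equivariant := pullbackSections_map_of_image_eq
          (N := ⟨fun U => N.sections U ⊓ L.sections U, _, fun U => fg_of_isLocallyNoetherian U _⟩)
          fun U V W hU hV => by
        refine Eq.trans (congrArg _ ((isBaseChangeAlong_pullbackSection (act G X) M.carrier U W
          hU).span_image_inf ((act G X).flat_appLE U.2 W.2 hU) _ _)) (Eq.trans ?_
          ((isBaseChangeAlong_pullbackSection (proj G X) M.carrier V W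
          hV).span_image_inf ((proj G X).flat_appLE V.2 W.2 hV) _ _).symm)
        rw [Submodule.map_inf _ (appEquiv M.lin W.1).injective]
        exact congrArg₂ _ (N.map_lin U V W hU hV) (L.map_lin U V W hU hV) }

@[simp]
lemma inf_sections (N L : GSubmodule M) (U : X.left.affineOpens) :
    (N ⊓ L).sections U = N.sections U ⊓ L.sections U := rfl

-- By flatness both extensions are colons of pulled-back submodules, and the isomorphism `Φ` carries
-- one pair of submodules to the other.
omit [IsLocallyNoetherian X.left] in
lemma isGIdeal_colon (N L : GSubmodule M) : IsGIdeal G (N.colon L) := by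
  refine isGIdeal_of_map_eq fun U V W hU hV => ?_
  rw [GSubmodule.colon, colon_ideal, colon_ideal]
  refine ((isBaseChangeAlong_pullbackSection (act G X) M.carrier U W hU).map_colon
    ((act G X).flat_appLE U.2 W.2 hU) _ _ (L.fg U)).trans (Eq.trans ?_
    ((isBaseChangeAlong_pullbackSection (proj G X) M.carrier V W hV).map_colon
    ((proj G X).flat_appLE V.2 W.2 hV) _ _ (L.fg V)).symm)
  have h1 := N.map_lin U V W hU hV
  have h2 := L.map_lin U V W hU hV
  unfold CoherentSubmodule.pullbackSections at h1 h2
  rw [← h1, ← h2]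
  ext r
  simp only [Submodule.mem_colon, Submodule.map_coe, Set.forall_mem_image]
  refine forall₂_congr fun m _ => ?_
  change _ ↔ r • (appEquiv M.lin W.1) m ∈ _
  rw [← map_smul]
  exact ((appEquiv M.lin W.1).injective.mem_set_image).symm

/-- The preimage of a `(G, 𝒪_X)`-submodule under a `(G, 𝒪_X)`-linear map. -/
def comap (π : M.carrier ⟶ K.carrier) (hπ : IsEquivariant π) (L : GSubmodule K) :
    GSubmodule M where
  sections U := (L.sections U).comap (appLinear π U)
  span_basicOpen U f := by
    refine ((isBaseChangeAlong_basicOpen M.carrier U f).comap_span_image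
      (isBaseChangeAlong_basicOpen K.carrier U f) (flat_basicOpen U f) (appLinear π U)
      (appLinear π (X.left.basicOpen f)) (fun m => ?_) _).symm.trans ?_
    · exact congr($(π.mapPresheaf.naturality (homOfLE (X.left.basicOpen_le f)).op) m)
    · exact congrArg _ (L.span_basicOpen U f)
  fg U := fg_of_isLocallyNoetherian U _
  equivariant := pullbackSections_map_of_image_eq
      (N := ⟨fun U => (L.sections U).comap (appLinear π U), _,
        fun U => fg_of_isLocallyNoetherian U _⟩)
      fun U V W hU hV => by
    refine Eq.trans (congrArg _ ((isBaseChangeAlong_pullbackSection (act G X) M.carrier U W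
      hU).comap_span_image (isBaseChangeAlong_pullbackSection (act G X) K.carrier U W hU)
      ((act G X).flat_appLE U.2 W.2 hU) (appLinear π U)
      (appLinear ((Scheme.Modules.pullback (act G X)).map π) W)
      (pullbackSection_naturality _ _ _ _ _) _).symm) (Eq.trans ?_
      ((isBaseChangeAlong_pullbackSection (proj G X) M.carrier V W
      hV).comap_span_image (isBaseChangeAlong_pullbackSection (proj G X) K.carrier V W hV)
      ((proj G X).flat_appLE V.2 W.2 hV) (appLinear π V)
      (appLinear ((Scheme.Modules.pullback (proj G X)).map π) W)
      (pullbackSection_naturality _ _ _ _ _) _))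
    have h1 := L.map_lin U V W hU hV
    unfold CoherentSubmodule.pullbackSections at h1
    rw [← h1]
    ext y
    obtain ⟨x, rfl⟩ := (appEquiv M.lin W.1).surjective y
    have h2 : appLinear ((Scheme.Modules.pullback (proj G X)).map π) W (appEquiv M.lin W.1 x) =
        appEquiv K.lin W.1 (appLinear ((Scheme.Modules.pullback (act G X)).map π) W x) :=
      congr(Scheme.Modules.Hom.app $hπ W x).symm
    rw [Submodule.mem_comap, h2]
    refine ((appEquiv M.lin W.1).injective.mem_set_image).trans
      (Iff.trans ?_ ((appEquiv K.lin W.1).injective.mem_set_image).symm)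
    exact Iff.rfl

end GSubmodule

end

/-! ### Ideals of integral closed subschemes. -/

section

variable {X : Scheme.{u}}

lemma radical_eq_self_of_isReduced (𝔭 : X.IdealSheafData) [IsReduced 𝔭.subscheme] :
    𝔭.radical = 𝔭 := by
  ext U : 2
  rw [Scheme.IdealSheafData.radical_ideal, ← Scheme.IdealSheafData.ker_subschemeι_app,
    RingHom.ker_eq_comap_bot, ← Ideal.comap_radical]
  congr 1
  exact nilradical_eq_zero _

lemma isIrreducible_support (𝔭 : X.IdealSheafData) [IsIntegral 𝔭.subscheme] :
    IsIrreducible (𝔭.support : Set X) := by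
  rw [← Scheme.IdealSheafData.range_subschemeι, ← Set.image_univ]
  exact (IrreducibleSpace.isIrreducible_univ _).image _ 𝔭.subschemeι.continuous.continuousOn

lemma ne_top_of_isIntegral (𝔭 : X.IdealSheafData) [IsIntegral 𝔭.subscheme] : 𝔭 ≠ ⊤ := by
  rintro rfl
  obtain ⟨x, hx⟩ := (isIrreducible_support (⊤ : X.IdealSheafData)).nonempty
  rw [Scheme.IdealSheafData.support_top] at hx
  exact hx

/-- An irreducible support inside a union of two closed sets lies in one of them; reducedness turns
this back into an inclusion of ideals. -/
lemma le_or_le_of_mul_le (𝔭 : X.IdealSheafData) [IsIntegral 𝔭.subscheme]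
    {I J : X.IdealSheafData} (h : I * J ≤ 𝔭) : I ≤ 𝔭 ∨ J ≤ 𝔭 := by
  have key (K : X.IdealSheafData) (hK : (𝔭.support : Set X) ⊆ K.support) : K ≤ 𝔭 := by
    rw [← radical_eq_self_of_isReduced 𝔭, ← Scheme.IdealSheafData.vanishingIdeal_support,
      ← Scheme.IdealSheafData.le_support_iff_le_vanishingIdeal]
    exact hK
  have h1 : (𝔭.support : Set X) ⊆ I.support ∪ J.support :=
    Scheme.IdealSheafData.support_antitone h
  exact ((isPreirreducible_iff_isClosed_union_isClosed.1
    (isIrreducible_support 𝔭).isPreirreducible) _ _ I.support.isClosed J.support.isClosed h1).imp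
    (key I) (key J)

lemma isIntegral_subscheme_vanishingIdeal (Z : TopologicalSpace.Closeds X)
    (hZ : IsIrreducible (Z : Set X)) :
    IsIntegral (Scheme.IdealSheafData.vanishingIdeal Z).subscheme := by
  let 𝔭 := Scheme.IdealSheafData.vanishingIdeal Z
  have h1 : IsReduced 𝔭.subscheme := by
    have (U : 𝔭.subschemeCover.openCover.I₀) : IsReduced (𝔭.subschemeCover.openCover.X U) := by
      change X.affineOpens at U
      have : _root_.IsReduced (Γ(X, U) ⧸ 𝔭.ideal U) := by
        rw [← Ideal.isRadical_iff_quotient_reduced]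
        exact PrimeSpectrum.isRadical_vanishingIdeal _
      exact inferInstanceAs (IsReduced (Spec (.of (Γ(X, U) ⧸ 𝔭.ideal U))))
    exact IsReduced.of_openCover _ 𝔭.subschemeCover.openCover
  have h2 : IrreducibleSpace 𝔭.subscheme := isIrreducible_iff_irreducibleSpace.1 hZ
  exact isIntegral_of_irreducibleSpace_of_isReduced _

lemma exists_pow_le_of_le_radical [AlgebraicGeometry.IsNoetherian X] {I J : X.IdealSheafData}
    (h : I ≤ J.radical) : ∃ n : ℕ, I ^ n ≤ J := by
  have key (U : X.affineOpens) : ∃ n : ℕ, I.ideal U ^ n ≤ J.ideal U := by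
    have := IsLocallyNoetherian.component_noetherian U
    exact Ideal.exists_pow_le_of_le_radical_of_fg (h U) (IsNoetherian.noetherian _)
  choose n hn using key
  obtain ⟨t, ht⟩ := isCompact_univ.elim_finite_subcover (fun U : X.affineOpens => (U.1 : Set X))
    (fun U => U.1.2) (fun x _ => by
      have : x ∈ ⨆ U : X.affineOpens, (U : X.Opens) := by
        rw [iSup_affineOpens_eq_top]
        trivial
      exact Set.mem_iUnion.2 (TopologicalSpace.Opens.mem_iSup.1 this))
  refine ⟨t.sup n, Scheme.IdealSheafData.le_of_iSup_eq_top (fun U : t => U.1) ?_ ?_⟩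
  · refine eq_top_iff.2 fun x _ => TopologicalSpace.Opens.mem_iSup.2 ?_
    obtain ⟨U, hU, hx⟩ := Set.mem_iUnion₂.1 (ht (Set.mem_univ x))
    exact ⟨⟨U, hU⟩, hx⟩
  · exact fun U => (Ideal.pow_le_pow_right (Finset.le_sup U.2)).trans (hn U)

/-- The ideals are those of finitely many irreducible closed subsets covering the support. -/
lemma exists_finset_radical_eq_inf [AlgebraicGeometry.IsNoetherian X] (I : X.IdealSheafData) :
    ∃ s : Finset X.IdealSheafData, (∀ 𝔭 ∈ s, IsIntegral 𝔭.subscheme) ∧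
      I.radical = s.inf id := by
  classical
  obtain ⟨T, hT, hirr, hsup⟩ :=
    TopologicalSpace.NoetherianSpace.exists_finite_set_closeds_irreducible I.support
  refine ⟨hT.toFinset.image Scheme.IdealSheafData.vanishingIdeal, ?_, ?_⟩
  · simp only [Finset.mem_image, Set.Finite.mem_toFinset]
    rintro _ ⟨Z, hZ, rfl⟩
    exact isIntegral_subscheme_vanishingIdeal Z (hirr Z hZ)
  · rw [← Scheme.IdealSheafData.vanishingIdeal_support, hsup,
      Scheme.IdealSheafData.vanishingIdeal_sSup, Finset.inf_image, Finset.inf_eq_iInf]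
    simp

end

/-! ### `G`-prime ideals and `G`-radicals. -/

section

variable {S : Scheme.{u}} {G X : Over S} [GrpObj G] [ModObj G X] {I J P : X.left.IdealSheafData}

lemma isGIdeal_top : IsGIdeal G (⊤ : X.left.IdealSheafData) := by
  rw [IsGIdeal, Scheme.IdealSheafData.comap_top, Scheme.IdealSheafData.comap_top]

lemma isGIdeal_sSup {s : Set X.left.IdealSheafData} (hs : ∀ I ∈ s, IsGIdeal G I) :
    IsGIdeal G (sSup s) := by
  unfold IsGIdeal
  rw [(Scheme.IdealSheafData.map_gc (act G X)).l_sSup,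
    (Scheme.IdealSheafData.map_gc (proj G X)).l_sSup]
  exact biSup_congr hs

lemma IsGIdeal.mul (hI : IsGIdeal G I) (hJ : IsGIdeal G J) : IsGIdeal G (I * J) :=
  isGIdeal_of_map_eq fun U V W hU hV => by
    simp only [Scheme.IdealSheafData.ideal_mul, Pi.mul_apply, Ideal.map_mul,
      hI.map_eq U V W hU hV, hJ.map_eq U V W hU hV]

lemma IsGIdeal.pow (hI : IsGIdeal G I) (n : ℕ) : IsGIdeal G (I ^ n) :=
  isGIdeal_of_map_eq fun U V W hU hV => by
    simp only [Scheme.IdealSheafData.ideal_pow, Pi.pow_apply, Ideal.map_pow,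
      hI.map_eq U V W hU hV]

lemma isGIdeal_star (𝔞 : X.left.IdealSheafData) : IsGIdeal G (star G 𝔞) :=
  isGIdeal_sSup fun _ h => h.1

lemma star_le (𝔞 : X.left.IdealSheafData) : star G 𝔞 ≤ 𝔞 := sSup_le fun _ h => h.2

lemma le_star (hI : IsGIdeal G I) (h : I ≤ J) : I ≤ star G J := le_sSup ⟨hI, h⟩

lemma isGIdeal_gRadical (I : X.left.IdealSheafData) : IsGIdeal G (gRadical G I) :=
  isGIdeal_sSup fun _ h => h.1

lemma le_gRadical (hI : IsGIdeal G I) : I ≤ gRadical G I := le_sSup ⟨hI, fun _ _ h => h⟩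

lemma gRadical_le (hP : IsGPrime G P) (h : I ≤ P) : gRadical G I ≤ P :=
  sSup_le fun _ hJ => hJ.2 P hP h

lemma isGPrime_star (𝔭 : X.left.IdealSheafData) [h : IsIntegral 𝔭.subscheme] :
    IsGPrime G (star G 𝔭) := ⟨isGIdeal_star 𝔭, 𝔭, h, rfl⟩

lemma IsGPrime.ne_top (hP : IsGPrime G P) : P ≠ ⊤ := by
  obtain ⟨-, 𝔭, h𝔭, rfl⟩ := hP
  exact fun h => ne_top_of_isIntegral 𝔭 (top_le_iff.1 (h.ge.trans (star_le 𝔭)))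

lemma IsGPrime.le_or_le (hP : IsGPrime G P) (hI : IsGIdeal G I) (hJ : IsGIdeal G J)
    (h : I * J ≤ P) : I ≤ P ∨ J ≤ P := by
  obtain ⟨-, 𝔭, h𝔭, rfl⟩ := hP
  exact (le_or_le_of_mul_le 𝔭 (h.trans (star_le 𝔭))).imp (le_star hI) (le_star hJ)

/-- Primality is a hypothesis on `P` rather than `IsGPrime` because the lemma also serves to prove
`G`-primeness. -/
lemma exists_le_of_prod_le (hP : P ≠ ⊤) (hprime : ∀ I J : X.left.IdealSheafData, IsGIdeal G I →
    IsGIdeal G J → I * J ≤ P → I ≤ P ∨ J ≤ P) {ι : Type*} (s : Finset ι)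
    (f : ι → X.left.IdealSheafData) (hf : ∀ i ∈ s, IsGIdeal G (f i)) (h : ∏ i ∈ s, f i ≤ P) :
    ∃ i ∈ s, f i ≤ P := by
  classical
  have key : IsGIdeal G (∏ i ∈ s, f i) ∧ (∏ i ∈ s, f i ≤ P → ∃ i ∈ s, f i ≤ P) := by
    clear h
    induction s using Finset.induction_on with
    | empty =>
      rw [Finset.prod_empty]
      exact ⟨isGIdeal_top, fun h => (hP (top_le_iff.1 h)).elim⟩
    | insert a s ha ih =>
      obtain ⟨h1, h2⟩ := ih fun i hi => hf i (Finset.mem_insert_of_mem hi)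
      have h3 := hf a (Finset.mem_insert_self a s)
      rw [Finset.prod_insert ha]
      refine ⟨h3.mul h1, fun h => ?_⟩
      rcases hprime _ _ h3 h1 h with h | h
      · exact ⟨a, Finset.mem_insert_self a s, h⟩
      · obtain ⟨i, hi, h⟩ := h2 h
        exact ⟨i, Finset.mem_insert_of_mem hi, h⟩
  exact key.2 h

lemma le_of_pow_le (hP : P ≠ ⊤) (hprime : ∀ I J : X.left.IdealSheafData, IsGIdeal G I →
    IsGIdeal G J → I * J ≤ P → I ≤ P ∨ J ≤ P) (hI : IsGIdeal G I) (n : ℕ) (h : I ^ n ≤ P) :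
    I ≤ P := by
  obtain ⟨-, -, h⟩ := exists_le_of_prod_le hP hprime (Finset.range n) (fun _ => I)
    (fun _ _ => hI) (by rwa [Finset.prod_const, Finset.card_range])
  exact h

lemma prod_le_of_mem {ι : Type*} (s : Finset ι) (f : ι → X.left.IdealSheafData) {i : ι}
    (hi : i ∈ s) : ∏ i ∈ s, f i ≤ f i := by
  classical
  rw [← Finset.mul_prod_erase s f hi]
  intro U
  change (f i).ideal U * (∏ j ∈ s.erase i, f j).ideal U ≤ (f i).ideal U
  exact Ideal.mul_le_left

variable [AlgebraicGeometry.IsNoetherian X.left]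

/-- If the radical of `P` is the intersection of primes `𝔭`, a power of `∏ 𝔭^*` lies in `P`, so some
`𝔭^* ≤ P`; the reverse inclusion follows from `P ≤ 𝔭`. -/
theorem isGPrime_of_prime (hP : P ≠ ⊤) (hP' : IsGIdeal G P)
    (hprime : ∀ I J : X.left.IdealSheafData, IsGIdeal G I → IsGIdeal G J → I * J ≤ P →
      I ≤ P ∨ J ≤ P) : IsGPrime G P := by
  obtain ⟨s, hs, hrad⟩ := exists_finset_radical_eq_inf P
  have h1 : ∏ 𝔭 ∈ s, star G 𝔭 ≤ P.radical := by
    rw [hrad]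
    exact Finset.le_inf fun 𝔭 h𝔭 => (prod_le_of_mem s (star G) h𝔭).trans (star_le 𝔭)
  obtain ⟨n, hn⟩ := exists_pow_le_of_le_radical h1
  rw [← Finset.prod_pow] at hn
  obtain ⟨𝔭, h𝔭, h2⟩ := exists_le_of_prod_le hP hprime s _
    (fun 𝔭 _ => (isGIdeal_star 𝔭).pow n) hn
  have h3 : P ≤ 𝔭 := (P.le_radical.trans hrad.le).trans (Finset.inf_le h𝔭)
  exact ⟨hP', 𝔭, hs 𝔭 h𝔭, le_antisymm (le_star hP' h3)
    (le_of_pow_le hP hprime (isGIdeal_star 𝔭) n h2)⟩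

/-- The `G`-radical lies in the ordinary radical: each prime `𝔭` in a finite decomposition of the
latter yields a `G`-prime `𝔭^*` containing `I`. -/
theorem exists_gRadical_pow_le (hI : IsGIdeal G I) : ∃ n : ℕ, gRadical G I ^ n ≤ I := by
  obtain ⟨s, hs, hrad⟩ := exists_finset_radical_eq_inf I
  refine exists_pow_le_of_le_radical ?_
  rw [hrad]
  refine Finset.le_inf fun 𝔭 h𝔭 => ?_
  have := hs 𝔭 h𝔭
  have h : I ≤ 𝔭 := (I.le_radical.trans hrad.le).trans (Finset.inf_le h𝔭)
  exact (gRadical_le (isGPrime_star 𝔭) (le_star hI h)).trans (star_le 𝔭)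

end

/-! ### `G`-primary submodules and uniqueness. -/

section

variable {S : Scheme.{u}} {G X : Over S} [GrpObj G] [ModObj G X]

lemma le_gRadical_of_pow_le {I J : X.left.IdealSheafData} (hI : IsGIdeal G I) (n : ℕ)
    (h : I ^ n ≤ gRadical G J) : I ≤ gRadical G J :=
  le_sSup ⟨hI, fun _ hP hJ => le_of_pow_le hP.ne_top (fun _ _ => hP.le_or_le) hI n
    (h.trans (gRadical_le hP hJ))⟩

variable {M : CoherentGModule G X}

lemma GSubmodule.le_colon_iff (N L : GSubmodule M) (P : X.left.IdealSheafData) :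
    P ≤ N.colon L ↔ ∀ U, P.ideal U • L.sections U ≤ N.sections U :=
  GPrimary.le_colon_iff _ _ _

variable [AlgebraicGeometry.IsNoetherian X.left]

lemma GSubmodule.le_colonTop_iff (N : GSubmodule M) (P : X.left.IdealSheafData) :
    P ≤ N.colonTop ↔ ∀ U, P.ideal U • (⊤ : Submodule Γ(X.left, U) Γ(M.carrier, U)) ≤
      N.sections U :=
  N.le_colon_iff ⊤ P

variable [Flat (proj G X)]

lemma GSubmodule.isGIdeal_colonTop (N : GSubmodule M) : IsGIdeal G N.colonTop :=
  N.isGIdeal_colon ⊤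

omit [Flat (proj G X)] in
lemma GSubmodule.colonTop_le_colon (N L : GSubmodule M) : N.colonTop ≤ N.colon L :=
  (N.le_colon_iff L _).2 fun U => (Submodule.smul_mono le_rfl le_top).trans
    ((N.le_colonTop_iff _).1 le_rfl U)

lemma GSubmodule.exists_sections_eq_iInf {ι : Type*} (s : Finset ι) (Q : ι → GSubmodule M) :
    ∃ L : GSubmodule M, ∀ U, L.sections U = ⨅ i ∈ s, (Q i).sections U := by
  classical
  induction s using Finset.induction_on with
  | empty => exact ⟨⊤, fun U => by simp⟩
  | insert a s _ ih =>
    obtain ⟨L, hL⟩ := ih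
    exact ⟨Q a ⊓ L, fun U => by rw [inf_sections, hL, Finset.iInf_insert]⟩

theorem GSubmodule.IsGPrimary.isGPrime_gRadical {Q : GSubmodule M} (hQ : Q.IsGPrimary) :
    IsGPrime G (gRadical G Q.colonTop) := by
  obtain ⟨n, hn⟩ := exists_gRadical_pow_le Q.isGIdeal_colonTop
  refine isGPrime_of_prime (fun h => ?_) (isGIdeal_gRadical _) fun I J hI hJ hIJ => ?_
  · obtain ⟨U, hU⟩ := hQ.1
    rw [h, ← Scheme.IdealSheafData.one_eq_top, one_pow, Q.le_colonTop_iff] at hn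
    refine hU (top_le_iff.1 (le_trans ?_ (hn U)))
    exact (Submodule.top_smul _).ge
  · have h1 : I ^ n * J ^ n ≤ Q.colonTop :=
      (mul_pow I J n).ge.trans ((pow_le_pow_left' hIJ n).trans hn)
    by_cases h2 : J ^ n ≤ Q.colonTop
    · exact .inr (le_gRadical_of_pow_le hJ n (h2.trans (le_gRadical Q.isGIdeal_colonTop)))
    · refine .inl (le_gRadical_of_pow_le hI n ?_)
      -- Primariness is applied to the submodule `J ^ n M`, which is not inside `Q`.
      refine hQ.2 (.smul (J ^ n) (hJ.pow n) ⊤) (I ^ n) (hI.pow n) (fun U => ?_) fun h => ?_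
      · refine le_trans ?_ ((Q.le_colonTop_iff _).1 h1 U)
        exact (Submodule.mul_smul _ _ _).ge
      · exact h2 ((Q.le_colonTop_iff _).2 h)

theorem range_gRadical_colonTop {N : GSubmodule M} {r : ℕ} {Q : Fin r → GSubmodule M}
    (h : IsMinimalGPrimaryDecomposition N Q) :
    Set.range (fun i => gRadical G (Q i).colonTop) =
      {P | (∃ L : GSubmodule M, P = N.colon L) ∧ IsGPrime G P} := by
  have hNQ (i : Fin r) (U) : N.sections U ≤ (Q i).sections U := by
    rw [h.eq_inf]
    exact iInf_le _ i
  ext P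
  constructor
  · rintro ⟨i, rfl⟩
    dsimp only
    refine ⟨?_, (h.primary i).isGPrime_gRadical⟩
    let P := gRadical G (Q i).colonTop
    have hP : IsGIdeal G P := isGIdeal_gRadical _
    obtain ⟨n, hn⟩ := exists_gRadical_pow_le (Q i).isGIdeal_colonTop
    obtain ⟨N', hN'⟩ := GSubmodule.exists_sections_eq_iInf ({i}ᶜ : Finset (Fin r)) Q
    have hN'' (U) : N'.sections U = ⨅ j, ⨅ _ : j ≠ i, (Q j).sections U := by
      simp [hN']
    have hinf (U) : N.sections U = (Q i).sections U ⊓ N'.sections U := by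
      rw [h.eq_inf, hN'']
      refine le_antisymm (le_inf (iInf_le _ i) (le_iInf₂ fun j _ => iInf_le _ j))
        (le_iInf fun j => ?_)
      by_cases hj : j = i
      · subst hj
        exact inf_le_left
      · exact inf_le_right.trans (iInf₂_le j hj)
    have hex : ∃ n, P ^ n ≤ N.colon N' := by
      refine ⟨n, (N.le_colon_iff _ _).2 fun U => ?_⟩
      rw [hinf]
      exact le_inf (((Q i).le_colon_iff _ _).1 (hn.trans ((Q i).colonTop_le_colon N')) U)
        Submodule.smul_le_right
    classical
    have hmin := Nat.find_spec hex
    have hmin' := fun m => Nat.find_min hex (m := m)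
    cases hk : Nat.find hex with
    | zero =>
      -- Exponent zero would mean `N' ≤ N`, making `Q i` redundant.
      rw [hk, pow_zero, GSubmodule.le_colon_iff] at hmin
      refine (h.irredundant i fun U => ?_).elim
      rw [← hN'']
      refine le_antisymm ((hinf U).le.trans inf_le_right) (le_trans ?_ (hmin U))
      exact (Submodule.top_smul _).ge
    | succ m =>
      rw [hk] at hmin hmin'
      -- One power below the least one: `P L ⊆ N`, but `L ⊄ N`.
      let L := N'.smul (P ^ m) (hP.pow m)
      have hL : ¬ ∀ U, L.sections U ≤ N.sections U := fun hL =>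
        hmin' m (Nat.lt_succ_self m) ((N.le_colon_iff _ _).2 hL)
      refine ⟨L, le_antisymm ?_ ?_⟩
      · rw [N.le_colon_iff] at hmin ⊢
        intro U
        refine le_trans ?_ (hmin U)
        rw [pow_succ']
        exact (Submodule.mul_smul _ _ _).ge
      -- Since `L ≤ N'` and `N = Q i ⊓ N'`, `L ⊄ N` gives `L ⊄ Q i`, so primariness bounds `N : L`.
      · refine (h.primary i).2 L _ (N.isGIdeal_colon L)
          (fun U => ((N.le_colon_iff L _).1 le_rfl U).trans (hNQ i U)) fun hLQ => hL fun U => ?_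
        rw [hinf]
        exact le_inf (hLQ U) Submodule.smul_le_right
  · rintro ⟨⟨L, rfl⟩, hP⟩
    -- For `r = 0` the empty product is the unit ideal, which no `G`-prime contains.
    obtain ⟨i, -, hi⟩ := exists_le_of_prod_le hP.ne_top (fun _ _ => hP.le_or_le) Finset.univ
      (fun i => (Q i).colon L) (fun i _ => (Q i).isGIdeal_colon L)
      ((N.le_colon_iff L _).2 fun U => by
        rw [h.eq_inf]
        exact le_iInf fun i => (Submodule.smul_mono_left
          (prod_le_of_mem _ _ (Finset.mem_univ i) U)).trans (((Q i).le_colon_iff L _).1 le_rfl U))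
    have hi' : N.colon L ≤ (Q i).colon L := ((Q i).le_colon_iff L _).2 fun U =>
      ((N.le_colon_iff L _).1 le_rfl U).trans (hNQ i U)
    obtain ⟨n, hn⟩ := exists_gRadical_pow_le (Q i).isGIdeal_colonTop
    refine ⟨i, le_antisymm (le_of_pow_le hP.ne_top (fun _ _ => hP.le_or_le) (isGIdeal_gRadical _) n
      ((hn.trans ((Q i).colonTop_le_colon L)).trans hi)) ?_⟩
    refine (h.primary i).2 L _ hP.1 (fun U => ((N.le_colon_iff L _).1 le_rfl U).trans (hNQ i U))
      fun hLQ => hP.ne_top (top_le_iff.1 (le_trans ?_ hi))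
    exact ((Q i).le_colon_iff L _).2 fun U => Submodule.smul_le_right.trans (hLQ U)

omit [Flat (proj G X)] in
lemma IsQuotient.colon_eq {N : GSubmodule M} {K : CoherentGModule G X}
    {π : M.carrier ⟶ K.carrier} (h : IsQuotient N π) (L : GSubmodule M) :
    N.colon L = GPrimary.colon (fun _ => ⊥) (L.map π h.equivariant).sections := by
  refine congrArg Scheme.IdealSheafData.ofIdeals (funext fun U => ?_)
  refine Submodule.ext fun (r : Γ(X.left, U)) => ?_
  simp only [Submodule.mem_colon, GSubmodule.map_sections, Submodule.map_coe,
    Set.forall_mem_image, Submodule.mem_bot]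
  refine forall₂_congr fun m _ => (h.ker U _).trans ?_
  exact iff_of_eq (congrArg (· = (0 : Γ(K.carrier, U))) ((appLinear π U).map_smul r m))

/-- `π` is surjective on affine sections, so every submodule of `K` is the image of its preimage. -/
lemma IsQuotient.exists_colon_iff {N : GSubmodule M} {K : CoherentGModule G X}
    {π : M.carrier ⟶ K.carrier} (h : IsQuotient N π) (P : X.left.IdealSheafData) :
    (∃ L : GSubmodule M, P = N.colon L) ↔
      ∃ L : GSubmodule K, P = GPrimary.colon (fun _ => ⊥) L.sections := by
  constructor
  · rintro ⟨L, rfl⟩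
    exact ⟨_, h.colon_eq L⟩
  · rintro ⟨L, rfl⟩
    refine ⟨L.comap π h.equivariant, ?_⟩
    rw [h.colon_eq]
    congr 1
    funext U
    have := h.epi
    exact (Submodule.map_comap_eq_of_surjective (f := appLinear π U)
      (surjective_app_of_epi π U) _).symm

end

end GPrimary
end

theorem mainTheorem2 {S : Scheme.{u}} (G X : Over S) [GrpObj G] [ModObj G X]
    [AlgebraicGeometry.IsNoetherian X.left] [AlgebraicGeometry.Flat (GPrimary.proj G X)]
    (M : GPrimary.CoherentGModule G X) (N : GPrimary.GSubmodule M) :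
    -- the `G`-radicals of the `Q_i : M` are exactly the `G`-prime colon ideals `N : L`
    (∀ (r : ℕ) (Q : Fin r → GPrimary.GSubmodule M),
      GPrimary.IsMinimalGPrimaryDecomposition N Q →
        Set.range (fun i => GPrimary.gRadical G (Q i).colonTop) =
          {P | (∃ L : GPrimary.GSubmodule M, P = N.colon L) ∧ GPrimary.IsGPrime G P}) ∧
    -- this set is independent of the choice of the decomposition
    (∀ (r r' : ℕ) (Q : Fin r → GPrimary.GSubmodule M) (Q' : Fin r' → GPrimary.GSubmodule M),
      GPrimary.IsMinimalGPrimaryDecomposition N Q →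
      GPrimary.IsMinimalGPrimaryDecomposition N Q' →
        Set.range (fun i => GPrimary.gRadical G (Q i).colonTop) =
          Set.range (fun i => GPrimary.gRadical G (Q' i).colonTop)) ∧
    -- it depends only on the `(G, 𝒪_X)`-module `M / N`
    (∀ (M' : GPrimary.CoherentGModule G X) (N' : GPrimary.GSubmodule M')
      (K : GPrimary.CoherentGModule G X)
      (π : M.carrier ⟶ K.carrier) (π' : M'.carrier ⟶ K.carrier),
      GPrimary.IsQuotient N π → GPrimary.IsQuotient N' π' →
      ∀ (r r' : ℕ) (Q : Fin r → GPrimary.GSubmodule M) (Q' : Fin r' → GPrimary.GSubmodule M'),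
        GPrimary.IsMinimalGPrimaryDecomposition N Q →
        GPrimary.IsMinimalGPrimaryDecomposition N' Q' →
          Set.range (fun i => GPrimary.gRadical G (Q i).colonTop) =
            Set.range (fun i => GPrimary.gRadical G (Q' i).colonTop)) := by
  refine ⟨fun r Q h => GPrimary.range_gRadical_colonTop h, fun r r' Q Q' h h' => ?_,
    fun M' N' K π π' hπ hπ' r r' Q Q' h h' => ?_⟩
  · rw [GPrimary.range_gRadical_colonTop h, GPrimary.range_gRadical_colonTop h']
  · rw [GPrimary.range_gRadical_colonTop h, GPrimary.range_gRadical_colonTop h']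
    ext P
    exact and_congr_left fun _ => (hπ.exists_colon_iff P).trans (hπ'.exists_colon_iff P).symm
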